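/- **Model.** Users are indexed by $u\in\mathbb N$; the system with $n$ users consists of the first $n$ of them, and $m=m(n)\to\infty$ data samples per user are observed. The parameters $p_u$ are drawn independently from a density $f_P$ with $\delta_1\le f_P\le\delta_2$ on $(0,1)$ for some $\delta_1,\delta_2>0$ and $f_P=0$ outside $(0,1)$. Given the $p_u$, the samples $(X_u(k))_u$, $k=1,2,\dots$, are i.i.d. in $k$, and $X_u(k)\sim\mathrm{Bernoulli}(p_u)$. The association graph $G$ with edge set $F$ does not depend on the drawn values $p_u$; it joins $u\ne u'$ if and only if $I(X_u(k);X_{u'}(k))>0$. Its connected components (the groups) are mutually independent, and all of them have at most $2$ vertices. Apart from this, the joint laws of the pairs are arbitrary. An obfuscation scheme gives every user a random noise parameter, drawn once and independently of everything else. Each group (an isolated user or an associated pair) then perturbs its samples one at a time, independently over times and groups given the noise parameters, by a channel that depends only on $n$, on the law of one data sample of the group, and on the noise parameters of the group; a user whose associate is not among the first $n$ users counts as isolated. The result is $\mathbf Z=(Z_u(k))$. Anonymization permutes the $n$ users by an independent uniformly random permutation $\Pi$, $\mathbf Y_{\Pi(u)}=\mathbf Z_u$, and $\mathbf Y=(\mathbf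 Y_1,\dots,\mathbf Y_n)$ is what the adversary observes. User $u$ has perfect privacy if $\lim_{n\to\infty}I(X_u(k);\mathbf Y)=0$ for every $k$, where the law is the one given the $p_u$. The asymptotic noise level of user $u$ is the highest probable fraction of corrupted data samples, $$\inf\Big\{\alpha:\ \lim_{n\to\infty}\mathbb P\big(\tfrac1m\#\{k\le m: Z_u(k)\ne X_u(k)\}>\alpha\big)=0\Big\}.$$ **Theorem.** There is an anonymization/obfuscation scheme such that for almost every draw of $(p_u)$, for all joint laws of the pairs as above, and for every $m(n)\to\infty$: all users have perfect privacy, and for all $(u,u')\in F$ the asymptotic noise levels of $u$ and of $u'$ are both at most $$a(u,u')=\frac{|\mathrm{Cov}(X_u(k),X_{u'}(k))|}{\max\{p_u,p_{u'},1-p_u,1-p_{u'}\}}.$$ -/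

import Mathlib

open MeasureTheory ProbabilityTheory Filter Topology

noncomputable section

open scoped Classical in
/-- The mutual information `I(A;B)` in nats of two finite-valued random variables with joint
probability mass function `P a b`. -/
def mutualInfo {α β : Type} [Fintype α] [Fintype β] (P : α → β → ℝ) : ℝ :=
  ∑ a, ∑ b, P a b * Real.log (P a b / ((∑ b', P a b') * (∑ a', P a' b)))

/-- `Q` is the law of one time sample `(X_u(k))_u` of the data of all users in the two-state model
(`true` is state `1`) with parameters `p_u` and association graph `G`: each `X_u(k)` is
Bernoulli(`p_u`), two users are adjacent iff the mutual information of their samples is positive,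
and the groups (connected components of `G`) are mutually independent. -/
structure IsTwoStateLaw (p : ℕ → ℝ) (G : SimpleGraph ℕ) (Q : Measure (ℕ → Bool)) : Prop where
  isProb : IsProbabilityMeasure Q
  bernoulli : ∀ u, Q.real {w | w u = true} = p u
  adj_iff : ∀ u v, u ≠ v →
    (G.Adj u v ↔ 0 < mutualInfo (fun a b : Bool => Q.real {w | w u = a ∧ w v = b}))
  groups_indep :
    iIndepFun (fun (C : G.ConnectedComponent) (w : ℕ → Bool) (u : C.supp) => w u) Q

/-- `Cov(X_u(k), X_v(k))` for a sample law `Q`. -/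
def sampleCov (Q : Measure (ℕ → Bool)) (u v : ℕ) : ℝ :=
  cov[fun w : ℕ → Bool => if w u then (1 : ℝ) else 0,
      fun w : ℕ → Bool => if w v then (1 : ℝ) else 0; Q]

/-- The values of the noise parameters. Every user draws one, uniformly on `[0,1]`, independently
of everything else, and keeps it for the whole data sequence. (A noise parameter with any other
law on the line is a function of such a uniform variable.) -/
abbrev Seed := unitInterval

/-- An obfuscation scheme in which associated users may collaborate. Every group of at most two
users perturbs its data samples one at a time, by means of a channel that depends on the number
`n` of users, on the law of one data sample of that group, and on the noise parameters of the
users in the group.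
`solo n ν r x` is the law of the reported sample of an isolated user with sample law `ν`, noise
parameter `r` and true sample `x`; `pair n ν r x` is the law of the pair of reported samples of two
associated users with joint sample law `ν`, noise parameters `r` and true samples `x`. -/
structure ObfuscationScheme where
  solo : ℕ → Measure Bool → Seed → Bool → PMF Bool
  pair : ℕ → Measure (Bool × Bool) → Seed × Seed → Bool × Bool → PMF (Bool × Bool)
  measurable_solo : ∀ n ν x z, Measurable (fun r => solo n ν r x z)
  measurable_pair : ∀ n ν x z, Measurable (fun r => pair n ν r x z)

namespace ObfuscationScheme

variable (S : ObfuscationScheme) (G : SimpleGraph ℕ) (Q : Measure (ℕ → Bool))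

open scoped Classical in
/-- In the system of the users `0, …, n-1`, with noise parameters `r`: the probability that the
true samples `x` of all users at a given time are reported as `z`. The first product is over the
users without an associate in the system, the second one over the associated pairs. -/
def channel (n : ℕ) (r : Fin n → Seed) (x z : Fin n → Bool) : ℝ :=
  (∏ u ∈ Finset.univ.filter (fun u : Fin n => ∀ v : Fin n, ¬ G.Adj u v),
    (S.solo n (Q.map fun w => w u) (r u) (x u) (z u)).toReal) *
  ∏ e ∈ Finset.univ.filter (fun e : Fin n × Fin n => e.1 < e.2 ∧ G.Adj e.1 e.2),
    (S.pair n (Q.map fun w => (w e.1, w e.2)) (r e.1, r e.2) (x e.1, x e.2)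
      (z e.1, z e.2)).toReal

/-- `ℙ(𝐗 = x, 𝐙 = z)` for the data matrix `𝐗` of `n` users and `m` samples per user (rows are
times, i.i.d. with law `Q` restricted to the first `n` users) and its obfuscated version `𝐙`. -/
def jointXZ (n m : ℕ) (x z : Fin m → Fin n → Bool) : ℝ :=
  (∏ k, Q.real {w | ∀ u : Fin n, w u = x k u}) *
    ∫ r : Fin n → Seed, ∏ k, S.channel G Q n r (x k) (z k)

/-- `ℙ(𝐗 = x, 𝐘 = y)` for the anonymized version `𝐘` of `𝐙`: with a uniformly random permutation
`Π` of the users, independent of all else, `𝐘_{Π(u)} = 𝐙_u` for every user `u`. -/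
def jointXY (n m : ℕ) (x y : Fin m → Fin n → Bool) : ℝ :=
  (n.factorial : ℝ)⁻¹ * ∑ π : Equiv.Perm (Fin n), S.jointXZ G Q n m x (fun k u => y k (π u))

open scoped Classical in
/-- `I(X_u(k); 𝐘)` in the system with `n` users and `m` samples per user; it is `0` by convention
if the system does not contain the sample `X_u(k)`. -/
def leakage (n m u k : ℕ) : ℝ :=
  if h : u < n ∧ k < m then
    mutualInfo (fun (a : Bool) (y : Fin m → Fin n → Bool) =>
      ∑ x : Fin m → Fin n → Bool with x ⟨k, h.2⟩ ⟨u, h.1⟩ = a, S.jointXY G Q n m x y)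
  else 0

/-- User `u` has perfect privacy: `I(X_u(k); 𝐘) → 0` as `n → ∞`, for every time `k`. -/
def PerfectPrivacy (m : ℕ → ℕ) (u : ℕ) : Prop :=
  ∀ k : ℕ, Tendsto (fun n => S.leakage G Q n (m n) u k) atTop (𝓝 0)

open scoped Classical in
/-- The probability that more than a fraction `α` of the `m` data samples of user `u` is
corrupted, `#{k | Z_u(k) ≠ X_u(k)} / m > α`, in the system with `n` users (`0` by convention if
`u` is not one of them). -/
def corruptionProb (n m u : ℕ) (α : ℝ) : ℝ :=
  if h : u < n then
    ∑ x : Fin m → Fin n → Bool, ∑ z : Fin m → Fin n → Bool,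
      if α < (Finset.card {k : Fin m | z k ⟨u, h⟩ ≠ x k ⟨u, h⟩} : ℝ) / m then
        S.jointXZ G Q n m x z
      else 0
  else 0

/-- The asymptotic noise level of user `u`, the highest probable fraction of corrupted data
samples: the least level which is exceeded by more than any given amount only with a probability
that vanishes as `n → ∞`. -/
def asymptoticNoiseLevel (m : ℕ → ℕ) (u : ℕ) : ℝ :=
  sInf {α : ℝ | Tendsto (fun n => S.corruptionProb G Q n (m n) u α) atTop (𝓝 0)}

end ObfuscationScheme

end

/-! The scheme turns the reports into independent Bernoulli variables with parameters on a finite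
grid, and plants decoys at every grid point.

Noise. With `N` of order `n^(1/4)`, an isolated user moves its sample law to the grid point below `p
u` with as few flips as possible (`shift`). In a pair, the user with the more predictable sample,
that is with the larger `max p (1 - p)`, does the same. The other one moves the conditional law of
its sample given the partner's sample to a single grid point: the rounding of its value at the
partner's likelier state. The two reports are then independent (`sum_mul_bern_pairParam`). Beyond
rounding, flips are needed only when the partner is in its unlikelier state, and their probability
is P(unlikelier) times the difference of the conditional probabilities. This equals |Cov| /
P(likelier) (`sum_keepFstParam_snd_not_le`), and P(likelier) is the maximum in the claimed bound. In
addition every user, with probability `1 / (N + 1)`, draws a uniform grid point and reports pure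
noise with that parameter at all times. This has vanishing probability, and otherwise the flips at
different times are independent, so Chebyshev's inequality gives the noise level
(`prodMean_frequency_le`, `corruptionProb_le`).

Privacy. Given the drawn labels, the reports are independent with parameters determined by the
labels (`sum_rowJoint_left`). The mean number `μ` of users drawing a given label is of order `n / (N
+ 1)^2`, hence of order `√n`, whatever the `p u` are. Transposing a user with a decoy of the same
label preserves the law of the whole report matrix. Anonymization therefore replaces the conditional
mean of a centred function of `X_u(k)` by its average over the decoys. The averaged terms are
centred and orthogonal, so the average is of order `μ^(-1/2)` in `L¹` (`sum_abs_perm_mean_le`,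
`sum_abs_perm_mean_pair_le`). Only row `k` is tested, so the bound is uniform in the number of
samples. Finally, mutual information with a Bernoulli(`p`) variable is at most this `L¹` distance
divided by `p (1 - p)` (`mutualInfo_mem_Icc`), and almost surely every `p u` lies strictly between 0
and 1. -/

noncomputable section

/-! ### Means under finite product weights -/

section ProdMean

variable {ι α : Type*} [Fintype ι] [DecidableEq ι] [Fintype α]

/-- The sum of `F` against the product of the weights `w i`. -/
def prodMean (w : ι → α → ℝ) (F : (ι → α) → ℝ) : ℝ :=
  ∑ f : ι → α, (∏ i, w i (f i)) * F f

theorem prodMean_congr (w : ι → α → ℝ) {F F' : (ι → α) → ℝ} (h : ∀ f, F f = F' f) :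
    prodMean w F = prodMean w F' := by
  simp only [prodMean, h]

theorem prodMean_add (w : ι → α → ℝ) (F F' : (ι → α) → ℝ) :
    prodMean w (fun f => F f + F' f) = prodMean w F + prodMean w F' := by
  simp [prodMean, mul_add, Finset.sum_add_distrib]

theorem prodMean_sum {κ : Type*} (w : ι → α → ℝ) (J : Finset κ) (F : κ → (ι → α) → ℝ) :
    prodMean w (fun f => ∑ j ∈ J, F j f) = ∑ j ∈ J, prodMean w (F j) := by
  simp only [prodMean, Finset.mul_sum]
  exact Finset.sum_comm

theorem prodMean_const_mul (w : ι → α → ℝ) (c : ℝ) (F : (ι → α) → ℝ) :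
    prodMean w (fun f => c * F f) = c * prodMean w F := by
  simp only [prodMean, Finset.mul_sum]
  exact Finset.sum_congr rfl fun f _ => by ring

theorem prodMean_mono {w : ι → α → ℝ} (h0 : ∀ i a, 0 ≤ w i a) {F F' : (ι → α) → ℝ}
    (h : ∀ f, F f ≤ F' f) : prodMean w F ≤ prodMean w F' :=
  Finset.sum_le_sum fun f _ =>
    mul_le_mul_of_nonneg_left (h f) (Finset.prod_nonneg fun i _ => h0 i _)

theorem prodMean_nonneg {w : ι → α → ℝ} (h0 : ∀ i a, 0 ≤ w i a) {F : (ι → α) → ℝ}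
    (h : ∀ f, 0 ≤ F f) : 0 ≤ prodMean w F :=
  Finset.sum_nonneg fun f _ => mul_nonneg (Finset.prod_nonneg fun i _ => h0 i _) (h f)

theorem prodMean_const {w : ι → α → ℝ} (h1 : ∀ i, ∑ a, w i a = 1) (c : ℝ) :
    prodMean w (fun _ => c) = c := by
  rw [prodMean, ← Finset.sum_mul, ← Fintype.prod_sum]
  simp [h1]

/-- Resampling one coordinate does not change the mean. -/
theorem prodMean_resample (w : ι → α → ℝ) (j : ι) (h1 : ∑ a, w j a = 1) (F : (ι → α) → ℝ) :
    prodMean w F = prodMean w (fun f => ∑ a, w j a * F (Function.update f j a)) := by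
  have hL : prodMean w F = ∑ q : (ι → α) × α, (∏ i, w i (q.1 i)) * (w j q.2 * F q.1) := by
    rw [Fintype.sum_prod_type]
    refine Finset.sum_congr rfl fun f _ => ?_
    dsimp only
    rw [← Finset.mul_sum, ← Finset.sum_mul, h1, one_mul]
  have hR : prodMean w (fun f => ∑ a, w j a * F (Function.update f j a)) =
      ∑ q : (ι → α) × α, (∏ i, w i (q.1 i)) * (w j q.2 * F (Function.update q.1 j q.2)) := by
    rw [Fintype.sum_prod_type]
    refine Finset.sum_congr rfl fun f _ => ?_
    dsimp only
    rw [← Finset.mul_sum]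
  rw [hL, hR]
  -- Exchanging the value at `j` with the fresh value is an involution that preserves the weight of
  -- the pair.
  let e : (ι → α) × α → (ι → α) × α := fun q => (Function.update q.1 j q.2, q.1 j)
  have he : Function.Involutive e := fun q => by simp [e]
  symm
  refine Fintype.sum_equiv he.toPerm _ _ fun q => ?_
  have hprod : ∀ (f : ι → α), ∏ i, w i (f i) = w j (f j) * ∏ i ∈ Finset.univ.erase j, w i (f i) :=
    fun f => (Finset.mul_prod_erase _ _ (Finset.mem_univ j)).symm
  have hrest : ∏ i ∈ Finset.univ.erase j, w i (Function.update q.1 j q.2 i) =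
      ∏ i ∈ Finset.univ.erase j, w i (q.1 i) :=
    Finset.prod_congr rfl fun i hi => by
      rw [Function.update_of_ne (Finset.ne_of_mem_erase hi)]
  simp only [Function.Involutive.coe_toPerm, e]
  rw [hprod q.1, hprod (Function.update q.1 j q.2), hrest]
  simp only [Function.update_self]
  ring

/-- A weighted sum over functions of a factor depending on a single coordinate. -/
theorem sum_prod_mul_apply (w : ι → α → ℝ) (k : ι) (ξ : α → ℝ) :
    ∑ f : ι → α, (∏ i, w i (f i)) * ξ (f k) =
      (∑ a, w k a * ξ a) * ∏ i ∈ Finset.univ.erase k, ∑ a, w i a := by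
  -- The factor `ξ` is absorbed into the weight of coordinate `k`, so that the sum factorizes.
  have h := Fintype.prod_sum (fun (i : ι) (a : α) => w i a * if i = k then ξ a else 1)
  rw [← Finset.mul_prod_erase _ _ (Finset.mem_univ k)] at h
  simp only [if_true] at h
  have h2 : ∏ i ∈ Finset.univ.erase k, ∑ a, w i a =
      ∏ i ∈ Finset.univ.erase k, ∑ a, w i a * (if i = k then ξ a else 1) :=
    Finset.prod_congr rfl fun i hi => by simp [Finset.ne_of_mem_erase hi]
  rw [h2, h]
  refine Finset.sum_congr rfl fun f _ => ?_
  rw [Finset.prod_mul_distrib, Finset.prod_ite_eq' Finset.univ k (fun i => ξ (f i))]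
  simp

theorem prodMean_apply {w : ι → α → ℝ} (h1 : ∀ i, ∑ a, w i a = 1) (k : ι) (ξ : α → ℝ) :
    prodMean w (fun f => ξ (f k)) = ∑ a, w k a * ξ a := by
  rw [prodMean, sum_prod_mul_apply]
  simp [h1]

/-- Jensen's inequality for the square. -/
theorem prodMean_abs_le_sqrt {w : ι → α → ℝ} (h0 : ∀ i a, 0 ≤ w i a)
    (h1 : ∀ i, ∑ a, w i a = 1) (F : (ι → α) → ℝ) :
    prodMean w (fun f => |F f|) ≤ √(prodMean w (fun f => F f ^ 2)) := by
  apply Real.le_sqrt_of_sq_le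
  set A := prodMean w (fun f => |F f|) with hA
  have h : 0 ≤ prodMean w (fun f => (|F f| - A) ^ 2) := prodMean_nonneg h0 fun f => sq_nonneg _
  have h2 : prodMean w (fun f => (|F f| - A) ^ 2) =
      prodMean w (fun f => F f ^ 2) + ((-2 * A) * prodMean w (fun f => |F f|) + A ^ 2) := by
    rw [← prodMean_const_mul, ← prodMean_const h1 (A ^ 2), ← prodMean_add, ← prodMean_add]
    refine prodMean_congr w fun f => ?_
    rw [← sq_abs (F f)]
    ring
  rw [← hA] at h2
  nlinarith

/-- The second moment of a sum of functions each of which is centred in a coordinate of its own. -/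
theorem prodMean_sq_sum {w : ι → α → ℝ} (h1 : ∀ i, ∑ a, w i a = 1) (J : Finset ι)
    (F : ι → (ι → α) → ℝ)
    (hmean : ∀ j ∈ J, ∀ f, ∑ a, w j a * F j (Function.update f j a) = 0)
    (hindep : ∀ i ∈ J, ∀ j ∈ J, i ≠ j → ∀ f a, F i (Function.update f j a) = F i f) :
    prodMean w (fun f => (∑ j ∈ J, F j f) ^ 2) = ∑ j ∈ J, prodMean w (fun f => F j f ^ 2) := by
  have h : ∀ f, (∑ j ∈ J, F j f) ^ 2 = ∑ j ∈ J, ∑ i ∈ J, F i f * F j f := fun f => by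
    rw [sq, Finset.sum_mul_sum, Finset.sum_comm]
  rw [prodMean_congr w h, prodMean_sum]
  refine Finset.sum_congr rfl fun j hj => ?_
  rw [prodMean_sum, Finset.sum_eq_single_of_mem j hj]
  · exact prodMean_congr w fun f => (sq _).symm
  · intro i hi hij
    -- Cross terms vanish: resampling coordinate `j` leaves `F i` fixed and averages `F j` to zero.
    rw [prodMean_resample w j (h1 j)]
    have : ∀ f, ∑ a, w j a * (F i (Function.update f j a) * F j (Function.update f j a)) = 0 := by
      intro f
      have h2 := hmean j hj f
      calc _ = F i f * ∑ a, w j a * F j (Function.update f j a) := by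
            rw [Finset.mul_sum]
            exact Finset.sum_congr rfl fun a _ => by rw [hindep i hi j hj hij]; ring
        _ = 0 := by rw [h2, mul_zero]
    rw [prodMean_congr w this, prodMean_const h1]

end ProdMean

/-! ### A bound on the mutual information with a two-valued variable -/

/-- The mutual information of a Bernoulli(`p`) variable with a finite-valued one is nonnegative and
at most the `L¹` distance between the joint law and the product law, up to a constant. -/
theorem mutualInfo_mem_Icc {β : Type} [Fintype β] (P : Bool → β → ℝ) (h0 : ∀ a y, 0 ≤ P a y)
    {p : ℝ} (hp0 : 0 < p) (hp1 : p < 1) (ht : ∑ y, P true y = p) (hf : ∑ y, P false y = 1 - p) :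
    mutualInfo P ∈ Set.Icc 0
      ((∑ y, |P true y - p * (P true y + P false y)|) / (p * (1 - p))) := by
  have hq : 0 < 1 - p := by linarith
  set B : β → ℝ := fun y => P true y + P false y with hB
  have hBsum : ∑ y, B y = 1 := by
    simp only [hB, Finset.sum_add_distrib, ht, hf]; ring
  have hmi : mutualInfo P = ∑ y, (P true y * Real.log (P true y / (p * B y)) +
      P false y * Real.log (P false y / ((1 - p) * B y))) := by
    rw [mutualInfo, Fintype.sum_bool, ht, hf, ← Finset.sum_add_distrib]
    simp [hB]
  have lo : ∀ s q : ℝ, 0 ≤ s → (0 < s → 0 < q) → 0 ≤ q → s - q ≤ s * Real.log (s / q) := by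
    intro s q hs hsq hq0
    rcases hs.eq_or_lt with rfl | hs
    · simpa using hq0
    · have hq' := hsq hs
      have := Real.one_sub_inv_le_log_of_pos (div_pos hs hq')
      have h3 := mul_le_mul_of_nonneg_left this hs.le
      rw [inv_div, mul_sub, mul_one, mul_div_cancel₀ _ hs.ne'] at h3
      exact h3
  -- From `log x ≤ x - 1`. The linear terms cancel between the two values of the Bernoulli variable,
  -- and a chi-square distance remains.
  have hi : ∀ s q : ℝ, 0 ≤ s → 0 < q → s * Real.log (s / q) ≤ (s - q) + (s - q) ^ 2 / q := by
    intro s q hs hq'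
    rcases hs.eq_or_lt with rfl | hs
    · have : (0 - q) + (0 - q) ^ 2 / q = 0 := by field_simp; ring
      rw [this]; simp
    · have := Real.log_le_sub_one_of_pos (div_pos hs hq')
      have h3 := mul_le_mul_of_nonneg_left this hs.le
      have : s * (s / q - 1) = (s - q) + (s - q) ^ 2 / q := by field_simp; ring
      linarith
  constructor
  · rw [hmi]
    have : ∑ y, ((P true y - p * B y) + (P false y - (1 - p) * B y)) = 0 :=
      Finset.sum_eq_zero fun y _ => by simp only [hB]; ring
    rw [← this]
    refine Finset.sum_le_sum fun y _ => ?_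
    have hb0 : 0 ≤ B y := add_nonneg (h0 _ _) (h0 _ _)
    refine add_le_add (lo _ _ (h0 _ _) (fun h => ?_) (by positivity))
      (lo _ _ (h0 _ _) (fun h => ?_) (by positivity))
    · have : 0 < B y := by have := h0 false y; simp only [hB]; linarith
      positivity
    · have : 0 < B y := by have := h0 true y; simp only [hB]; linarith
      positivity
  · rw [hmi, Finset.sum_div]
    refine Finset.sum_le_sum fun y _ => ?_
    have hb0 : 0 ≤ B y := add_nonneg (h0 _ _) (h0 _ _)
    rcases hb0.eq_or_lt with hb | hb
    · have h1 := h0 true y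
      have h2 := h0 false y
      have h3 : P true y = 0 := by simp only [hB] at hb; linarith
      have h4 : P false y = 0 := by simp only [hB] at hb; linarith
      simp [h3, h4]
    · have k1 := hi _ (p * B y) (h0 true y) (by positivity)
      have k2 := hi _ ((1 - p) * B y) (h0 false y) (by positivity)
      set D := P true y - p * B y with hD
      have hfy : P false y - (1 - p) * B y = - D := by simp only [hD, hB]; ring
      rw [hfy] at k2
      -- Since `D = (1 - p) * P true y - p * P false y`. This allows trading `D ^ 2 / B y` for
      -- `|D|`.
      have hDle : |D| ≤ B y := by
        have h1 := h0 true y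
        have h2 := h0 false y
        rw [abs_le]
        constructor <;> simp only [hD, hB] <;> nlinarith
      have e : D ^ 2 / (p * B y) + (-D) ^ 2 / ((1 - p) * B y) = D ^ 2 / B y / (p * (1 - p)) := by
        field_simp; ring
      have e2 : D ^ 2 / B y ≤ |D| := by
        rw [div_le_iff₀ hb, ← sq_abs, sq]
        exact mul_le_mul_of_nonneg_left hDle (abs_nonneg _)
      calc _ ≤ D ^ 2 / (p * B y) + (-D) ^ 2 / ((1 - p) * B y) := by linarith
        _ = D ^ 2 / B y / (p * (1 - p)) := e
        _ ≤ |D| / (p * (1 - p)) := by gcongr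

/-! ### Hiding a user among the users with the same label -/

/-- The probability mass function of the Bernoulli law with parameter `t`. -/
def bern (t : ℝ) (b : Bool) : ℝ := if b then t else 1 - t

theorem bern_nonneg {t : ℝ} (h : t ∈ Set.Icc (0 : ℝ) 1) (b : Bool) : 0 ≤ bern t b := by
  cases b <;> simp [bern, h.1, h.2]

theorem sum_bern (t : ℝ) : ∑ b, bern t b = 1 := by simp [bern]

section Hiding

variable {U L : Type*} [Fintype U]

/-- The label of user `v`: the one that was drawn, if any, and `tgt v` otherwise. -/
def labelOf (tgt : U → L) (c : U → Option L) (v : U) : L := (c v).getD (tgt v)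

/-- The probability of the row `z` of reports when user `v` has label `l v` and reports
independent Bernoulli variables of parameter `θ (l v)`. -/
def rowProb (θ : L → ℝ) (l : U → L) (z : U → Bool) : ℝ := ∏ v, bern (θ (l v)) (z v)

variable {θ : L → ℝ}

theorem rowProb_nonneg (hθ : ∀ ℓ, θ ℓ ∈ Set.Icc (0 : ℝ) 1) (l : U → L) (z : U → Bool) :
    0 ≤ rowProb θ l z :=
  Finset.prod_nonneg fun _ _ => bern_nonneg (hθ _) _

theorem sum_rowProb [DecidableEq U] (θ : L → ℝ) (l : U → L) : ∑ z, rowProb θ l z = 1 := by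
  have := prodMean_const (w := fun (v : U) (b : Bool) => bern (θ (l v)) b) (fun _ => sum_bern _) 1
  simpa [prodMean, rowProb] using this

/-- Users with equal labels are exchangeable; this symmetry is what hides a user among its decoys.
-/
theorem rowProb_comp_swap [DecidableEq U] {l : U → L} {v j : U} (h : l j = l v) (z : U → Bool) :
    rowProb θ l (z ∘ Equiv.swap v j) = rowProb θ l z := by
  unfold rowProb
  refine Fintype.prod_equiv (Equiv.swap v j) _ _ fun i => ?_
  have : l (Equiv.swap v j i) = l i := by
    rcases eq_or_ne i v with rfl | hv
    · simp [h]
    · rcases eq_or_ne i j with rfl | hj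
      · simp [h]
      · rw [Equiv.swap_apply_of_ne_of_ne hv hj]
  rw [this]; rfl

/-- For fixed labels, permuting the columns is a bijection of the report matrices, and the rows
other than `k` sum to one. Hence the number of rows plays no role. -/
theorem sum_abs_perm_mean_le_sum [DecidableEq U] {M : Type*} [Fintype M] [DecidableEq M]
    (hθ : ∀ ℓ, θ ℓ ∈ Set.Icc (0 : ℝ) 1) (l : U → L) (k : M) (H : (U → Bool) → ℝ)
    (π : Equiv.Perm U) :
    ∑ y : M → U → Bool, |H (y k ∘ π) * ∏ i, rowProb θ l (y i ∘ π)| =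
      ∑ z, rowProb θ l z * |H z| := by
  have e : ∑ y : M → U → Bool, |H (y k ∘ π) * ∏ i, rowProb θ l (y i ∘ π)| =
      ∑ y : M → U → Bool, |H (y k) * ∏ i, rowProb θ l (y i)| := by
    refine Fintype.sum_equiv (Equiv.piCongrRight fun _ => Equiv.arrowCongr π.symm (Equiv.refl _))
      _ _ fun y => ?_
    rfl
  rw [e]
  have := prodMean_apply (ι := M) (w := fun _ => rowProb θ l) (fun _ => sum_rowProb θ l) k
    (fun z => |H z|)
  rw [← this]
  refine Finset.sum_congr rfl fun y _ => ?_
  rw [abs_mul, abs_of_nonneg (Finset.prod_nonneg fun i _ => rowProb_nonneg hθ l _), mul_comm]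

/-- If `φ` is centred in the report of user `v` and depends on the users of `E` only, then averaging
over the random permutation and over the labels makes it disappear at rate `μ ^ (-1/2)`, where `μ`
is the mean number of users outside `E` that draw a given label. -/
theorem sum_abs_perm_mean_le [DecidableEq U] [Fintype L] [DecidableEq L] {M : Type*} [Fintype M] [DecidableEq M]
    (hθ : ∀ ℓ, θ ℓ ∈ Set.Icc (0 : ℝ) 1) (tgt : U → L) (w : Option L → ℝ) (hw0 : ∀ a, 0 ≤ w a)
    (hw1 : ∑ a, w a = 1) {q : ℝ} (hq : 0 < q) (hwq : ∀ ℓ, w (some ℓ) = q)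
    (v : U) (E : Finset U) (hv : v ∈ E) (hE : E.card < Fintype.card U) (k : M)
    (φ : (U → Option L) → (U → Bool) → ℝ) {C : ℝ} (hC : 0 ≤ C)
    (hφC : ∀ c z, |φ c z| ≤ C)
    (hφE : ∀ c z, ∀ j ∉ E, ∀ b, φ c (Function.update z j b) = φ c z)
    (hφ0 : ∀ c z, ∑ b, bern (θ (labelOf tgt c v)) b * φ c (Function.update z v b) = 0) :
    ∑ y : M → U → Bool, |((Fintype.card U).factorial : ℝ)⁻¹ * ∑ π : Equiv.Perm U,
      ∑ c : U → Option L, (∏ i, w (c i)) *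
        (φ c (y k ∘ π) * ∏ i, rowProb θ (labelOf tgt c) (y i ∘ π))| ≤
      2 * C / √((Fintype.card U - E.card : ℝ) * q) := by
  set J : Finset U := Finset.univ \ E with hJ
  have hJE : ∀ j ∈ J, j ∉ E := fun j hj => (Finset.mem_sdiff.1 hj).2
  have hJv : ∀ j ∈ J, j ≠ v := fun j hj h => hJE j hj (h ▸ hv)
  have hJcard : (J.card : ℝ) = Fintype.card U - E.card := by
    rw [hJ, Finset.card_sdiff_of_subset (Finset.subset_univ _), Finset.card_univ,
      Nat.cast_sub (Finset.card_le_univ _)]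
  set μ : ℝ := (Fintype.card U - E.card : ℝ) * q with hμ
  have hμ0 : 0 < μ := mul_pos (by rw [sub_pos]; exact_mod_cast hE) hq
  -- Indicator that `j` has drawn the label of `v`; for `j ∈ J` this makes `j` a decoy. The default
  -- label of `j` does not count, so the mean is `q` whatever `tgt` is.
  let g : U → (U → Option L) → ℝ := fun j c => if c j = some (labelOf tgt c v) then 1 else 0
  have hg01 : ∀ j c, g j c = 0 ∨ g j c = 1 := fun j c => by
    by_cases h : c j = some (labelOf tgt c v)
    · right; simp [g, h]
    · left; simp [g, h]
  have hg0 : ∀ j c, 0 ≤ g j c := fun j c => by rcases hg01 j c with h | h <;> rw [h]; norm_num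
  have hgne : ∀ j c, g j c ≠ 0 → labelOf tgt c j = labelOf tgt c v := by
    intro j c h
    have : c j = some (labelOf tgt c v) := by
      by_contra h'; exact h (by simp [g, h'])
    simp [labelOf, this]
  let S : (U → Option L) → ℝ := fun c => ∑ j ∈ J, g j c
  let W : U → Option L → ℝ := fun _ => w
  have hlabu : ∀ c j a, j ≠ v → labelOf tgt (Function.update c j a) v = labelOf tgt c v := by
    intro c j a h
    simp [labelOf, Function.update_of_ne (Ne.symm h)]
  have hgmean : ∀ j ∈ J, ∀ c, ∑ a, w a * g j (Function.update c j a) = q := by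
    intro j hj c
    simp only [g, hlabu c j _ (hJv j hj), Function.update_self]
    simp [hwq]
  have hEg : ∀ j ∈ J, prodMean W (g j) = q := by
    intro j hj
    rw [prodMean_resample W j hw1, prodMean_congr W (hgmean j hj), prodMean_const (fun _ => hw1)]
  have hES : prodMean W S = μ := by
    rw [prodMean_sum, Finset.sum_congr rfl hEg, Finset.sum_const, nsmul_eq_mul, hJcard]
  -- the fluctuations of the number of users with the label of `v`
  have hfluct : prodMean W (fun c => |μ - S c|) ≤ √μ := by
    refine (prodMean_abs_le_sqrt (fun _ => hw0) (fun _ => hw1) _).trans (Real.sqrt_le_sqrt ?_)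
    have e : ∀ c, (μ - S c) ^ 2 = (∑ j ∈ J, (g j c - q)) ^ 2 := by
      intro c
      rw [Finset.sum_sub_distrib, Finset.sum_const, nsmul_eq_mul, hJcard]
      simp only [S, hμ]; ring
    rw [prodMean_congr W e, prodMean_sq_sum (w := W) (fun _ => hw1) J (fun j c => g j c - q)]
    · rw [← hES, prodMean_sum]
      refine Finset.sum_le_sum fun j hj => ?_
      -- An indicator equals its square, so the variance is `q - q ^ 2 ≤ q`.
      have e2 : ∀ c, (g j c - q) ^ 2 = (1 - 2 * q) * g j c + q ^ 2 := by
        intro c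
        rcases hg01 j c with h | h <;> rw [h] <;> ring
      rw [prodMean_congr W e2, prodMean_add, prodMean_const_mul, hEg j hj,
        prodMean_const (fun _ => hw1)]
      nlinarith
    · intro j hj c
      simp only [mul_sub, Finset.sum_sub_distrib]
      rw [← Finset.sum_mul]
      have := hgmean j hj c
      simp only [W]
      rw [this, hw1]; ring
    · intro i hi j hj hij c a
      simp only [g, hlabu c j _ (hJv j hj), Function.update_of_ne hij]
  have hsqrtS : prodMean W (fun c => √(S c)) ≤ √μ := by
    have hS0 : ∀ c, 0 ≤ S c := fun c => Finset.sum_nonneg fun j _ => hg0 j c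
    have := prodMean_abs_le_sqrt (w := W) (fun _ => hw0) (fun _ => hw1) (fun c => √(S c))
    simp only [abs_of_nonneg (Real.sqrt_nonneg _), Real.sq_sqrt (hS0 _)] at this
    exact this.trans_eq (by rw [← hES])
  -- the average over the users with the label of `v`
  have havg : ∀ c, ∑ z, rowProb θ (labelOf tgt c) z * |∑ j ∈ J, g j c * φ c (z ∘ Equiv.swap v j)| ≤
      C * √(S c) := by
    intro c
    let B : U → Bool → ℝ := fun i => bern (θ (labelOf tgt c i))
    have hB0 : ∀ i b, 0 ≤ B i b := fun i b => bern_nonneg (hθ _) b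
    have hB1 : ∀ i, ∑ b, B i b = 1 := fun i => sum_bern _
    have h := prodMean_abs_le_sqrt hB0 hB1 (fun z => ∑ j ∈ J, g j c * φ c (z ∘ Equiv.swap v j))
    refine h.trans ?_
    have e : C * √(S c) = √(C ^ 2 * S c) := by
      rw [Real.sqrt_mul (sq_nonneg C), Real.sqrt_sq hC]
    rw [e]
    apply Real.sqrt_le_sqrt
    rw [prodMean_sq_sum hB1 J (fun j z => g j c * φ c (z ∘ Equiv.swap v j))]
    · simp only [S, Finset.mul_sum]
      refine Finset.sum_le_sum fun j hj => ?_
      rw [← prodMean_const hB1 (C ^ 2 * g j c)]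
      refine prodMean_mono hB0 fun z => ?_
      rcases hg01 j c with h | h <;> rw [h]
      · simp
      · rw [one_mul, mul_one, ← sq_abs (φ c _)]
        exact pow_le_pow_left₀ (abs_nonneg _) (hφC c _) 2
    · intro j hj z
      by_cases hgj : g j c = 0
      · simp [hgj]
      -- After the transposition, averaging over the report of `j` is averaging over that of `v`;
      -- the weights agree because the labels do, so `hφ0` applies.
      · have e : ∀ b, Function.update z j b ∘ Equiv.swap v j =
            Function.update (z ∘ Equiv.swap v j) v b := by
          intro b
          rw [Function.update_comp_equiv]; simp
        have hl := hgne j c hgj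
        have := hφ0 c (z ∘ Equiv.swap v j)
        simp only [B, e, hl]
        calc _ = g j c * ∑ b, bern (θ (labelOf tgt c v)) b *
              φ c (Function.update (z ∘ Equiv.swap v j) v b) := by
              rw [Finset.mul_sum]
              exact Finset.sum_congr rfl fun b _ => by ring
          _ = 0 := by rw [this, mul_zero]
    · intro i hi j hj hij z b
      have e : Function.update z j b ∘ Equiv.swap v i =
          Function.update (z ∘ Equiv.swap v i) j b := by
        rw [Function.update_comp_equiv, Equiv.symm_swap,
          Equiv.swap_apply_of_ne_of_ne (hJv j hj) (Ne.symm hij)]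
      simp only [e, hφE c _ j (hJE j hj)]
  -- transposing `v` with a user of the same label
  set T : (M → U → Bool) → ℝ := fun y => ((Fintype.card U).factorial : ℝ)⁻¹ *
    ∑ π : Equiv.Perm U, ∑ c : U → Option L, (∏ i, w (c i)) *
        (φ c (y k ∘ π) * ∏ i, rowProb θ (labelOf tgt c) (y i ∘ π)) with hT
  -- Write `μ = (μ - S c) + S c` and replace the `S c` copies of `φ` by one transposed copy for each
  -- decoy. The first summand is small because `S` concentrates at `μ`, the second because its terms
  -- are orthogonal.
  let R : (U → Option L) → (U → Bool) → ℝ := fun c z =>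
    (μ - S c) * φ c z + ∑ j ∈ J, g j c * φ c (z ∘ Equiv.swap v j)
  have hswap : ∀ (y : M → U → Bool) (c : U → Option L) (j : U),
      ∑ π : Equiv.Perm U, g j c * (φ c (y k ∘ π) * ∏ i, rowProb θ (labelOf tgt c) (y i ∘ π)) =
      ∑ π : Equiv.Perm U, g j c * (φ c ((y k ∘ π) ∘ Equiv.swap v j) *
        ∏ i, rowProb θ (labelOf tgt c) (y i ∘ π)) := by
    intro y c j
    by_cases hgj : g j c = 0
    · simp [hgj]
    -- The permutations are reindexed by `π ↦ π * swap v j`: all rows are transposed at once, and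
    -- their laws do not change.
    · rw [← Equiv.sum_comp (Equiv.mulRight (Equiv.swap v j))]
      refine Finset.sum_congr rfl fun π _ => ?_
      simp only [Equiv.coe_mulRight, Equiv.Perm.coe_mul, ← Function.comp_assoc]
      simp only [rowProb_comp_swap (hgne j c hgj)]
  have hμT : ∀ y, μ * T y = ((Fintype.card U).factorial : ℝ)⁻¹ *
      ∑ π : Equiv.Perm U, ∑ c : U → Option L, (∏ i, w (c i)) *
        (R c (y k ∘ π) * ∏ i, rowProb θ (labelOf tgt c) (y i ∘ π)) := by
    intro y
    simp only [hT]
    rw [mul_left_comm]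
    congr 1
    rw [Finset.sum_comm, Finset.mul_sum]
    rw [Finset.sum_comm (s := (Finset.univ : Finset (Equiv.Perm U)))]
    refine Finset.sum_congr rfl fun c _ => ?_
    rw [← Finset.mul_sum, ← Finset.mul_sum, mul_left_comm]
    congr 1
    have e1 : ∀ π : Equiv.Perm U,
        R c (y k ∘ π) * ∏ i, rowProb θ (labelOf tgt c) (y i ∘ π) =
        (μ - S c) * (φ c (y k ∘ π) * ∏ i, rowProb θ (labelOf tgt c) (y i ∘ π)) +
        ∑ j ∈ J, g j c * (φ c ((y k ∘ π) ∘ Equiv.swap v j) *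
          ∏ i, rowProb θ (labelOf tgt c) (y i ∘ π)) := by
      intro π
      simp only [R]
      rw [add_mul, Finset.sum_mul, mul_assoc]
      congr 1
      exact Finset.sum_congr rfl fun j _ => by ring
    rw [Finset.sum_congr rfl fun π _ => e1 π, Finset.sum_add_distrib, Finset.sum_comm,
      Finset.sum_congr rfl fun j _ => (hswap y c j).symm, ← Finset.mul_sum,
      Finset.sum_congr rfl fun j _ => (Finset.mul_sum _ _ _).symm, ← Finset.sum_mul]
    simp only [S]; ring
  have hR : ∀ c, ∑ z, rowProb θ (labelOf tgt c) z * |R c z| ≤ C * |μ - S c| + C * √(S c) := by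
    intro c
    calc _ ≤ ∑ z, (rowProb θ (labelOf tgt c) z * (C * |μ - S c|) + rowProb θ (labelOf tgt c) z *
          |∑ j ∈ J, g j c * φ c (z ∘ Equiv.swap v j)|) := by
          refine Finset.sum_le_sum fun z _ => ?_
          rw [← mul_add]
          refine mul_le_mul_of_nonneg_left ?_ (rowProb_nonneg hθ _ _)
          refine (abs_add_le _ _).trans (add_le_add_left ?_ _)
          rw [abs_mul, mul_comm]
          exact mul_le_mul_of_nonneg_right (hφC c z) (abs_nonneg _)
      _ ≤ _ := by
          rw [Finset.sum_add_distrib, ← Finset.sum_mul, sum_rowProb, one_mul]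
          exact add_le_add_right (havg c) _
  have hsum : μ * ∑ y, |T y| ≤ 2 * C * √μ := by
    calc μ * ∑ y, |T y| = ∑ y, |μ * T y| := by
          rw [Finset.mul_sum]
          exact Finset.sum_congr rfl fun y _ => by
            rw [abs_mul μ (T y), abs_of_pos hμ0]
      _ ≤ ∑ y : M → U → Bool, ((Fintype.card U).factorial : ℝ)⁻¹ * ∑ π : Equiv.Perm U, ∑ c : U → Option L,
          (∏ i, w (c i)) * |R c (y k ∘ π) * ∏ i, rowProb θ (labelOf tgt c) (y i ∘ π)| := by
          refine Finset.sum_le_sum fun y _ => ?_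
          rw [hμT, abs_mul, abs_of_nonneg (by positivity)]
          refine mul_le_mul_of_nonneg_left ?_ (by positivity)
          refine (Finset.abs_sum_le_sum_abs _ _).trans (Finset.sum_le_sum fun π _ => ?_)
          refine (Finset.abs_sum_le_sum_abs _ _).trans (Finset.sum_le_sum fun c _ => ?_)
          rw [abs_mul, abs_of_nonneg (Finset.prod_nonneg fun i _ => hw0 _)]
      _ = ((Fintype.card U).factorial : ℝ)⁻¹ * ∑ π : Equiv.Perm U, ∑ c : U → Option L,
          (∏ i, w (c i)) * ∑ z, rowProb θ (labelOf tgt c) z * |R c z| := by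
          rw [← Finset.mul_sum, Finset.sum_comm]
          congr 1
          refine Finset.sum_congr rfl fun π _ => ?_
          rw [Finset.sum_comm]
          refine Finset.sum_congr rfl fun c _ => ?_
          rw [← Finset.mul_sum, sum_abs_perm_mean_le_sum hθ]
      _ = ∑ c : U → Option L, (∏ i, w (c i)) * ∑ z, rowProb θ (labelOf tgt c) z * |R c z| := by
          rw [Finset.sum_const, Finset.card_univ, Fintype.card_perm, nsmul_eq_mul,
            inv_mul_cancel_left₀ (by positivity)]
      _ ≤ prodMean W (fun c => C * |μ - S c| + C * √(S c)) :=
          Finset.sum_le_sum fun c _ => mul_le_mul_of_nonneg_left (hR c)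
            (Finset.prod_nonneg fun i _ => hw0 _)
      _ ≤ 2 * C * √μ := by
          rw [prodMean_add, prodMean_const_mul, prodMean_const_mul]
          nlinarith [mul_le_mul_of_nonneg_left hfluct hC, mul_le_mul_of_nonneg_left hsqrtS hC]
  have hs : 0 < √μ := Real.sqrt_pos.2 hμ0
  rw [le_div_iff₀ hs]
  have hss : √μ * √μ = μ := Real.mul_self_sqrt hμ0.le
  nlinarith

/-- The variant of `sum_abs_perm_mean_le` for a function of two users that is centred only as a
function of both reports. -/
theorem sum_abs_perm_mean_pair_le [DecidableEq U] [Fintype L] [DecidableEq L] {M : Type*}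
    [Fintype M] [DecidableEq M]
    (hθ : ∀ ℓ, θ ℓ ∈ Set.Icc (0 : ℝ) 1) (tgt : U → L) (w : Option L → ℝ) (hw0 : ∀ a, 0 ≤ w a)
    (hw1 : ∑ a, w a = 1) {q : ℝ} (hq : 0 < q) (hwq : ∀ ℓ, w (some ℓ) = q)
    (v v' : U) (hvv : v ≠ v') (hE : 2 < Fintype.card U) (k : M)
    (ψ : (U → Option L) → (U → Bool) → ℝ)
    (hψ1 : ∀ c z, |ψ c z| ≤ 1)
    (hψE : ∀ c z j, j ≠ v → j ≠ v' → ∀ b, ψ c (Function.update z j b) = ψ c z)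
    (hψ0 : ∀ c z, ∑ b, bern (θ (labelOf tgt c v')) b * ∑ a, bern (θ (labelOf tgt c v)) a *
      ψ c (Function.update (Function.update z v' b) v a) = 0) :
    ∑ y : M → U → Bool, |((Fintype.card U).factorial : ℝ)⁻¹ * ∑ π : Equiv.Perm U,
      ∑ c : U → Option L, (∏ i, w (c i)) *
        (ψ c (y k ∘ π) * ∏ i, rowProb θ (labelOf tgt c) (y i ∘ π))| ≤
      6 / √((Fintype.card U - 2 : ℝ) * q) := by
  -- Averaging out the report of `v` splits `ψ` into `ψ - A`, centred in the report of `v` and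
  -- bounded by 2, and `A`, centred in that of `v'` and bounded by 1. Hence the constant `6 = 2 * 2
  -- + 2 * 1`.
  let A : (U → Option L) → (U → Bool) → ℝ := fun c z =>
    ∑ a, bern (θ (labelOf tgt c v)) a * ψ c (Function.update z v a)
  have hA1 : ∀ c z, |A c z| ≤ 1 := by
    intro c z
    calc |A c z| ≤ ∑ a, |bern (θ (labelOf tgt c v)) a * ψ c (Function.update z v a)| :=
          Finset.abs_sum_le_sum_abs _ _
      _ ≤ ∑ a, bern (θ (labelOf tgt c v)) a := by
          refine Finset.sum_le_sum fun a _ => ?_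
          rw [abs_mul, abs_of_nonneg (bern_nonneg (hθ _) _)]
          exact mul_le_of_le_one_right (bern_nonneg (hθ _) _) (hψ1 _ _)
      _ = 1 := sum_bern _
  have hcard : ({v, v'} : Finset U).card = 2 := Finset.card_pair hvv
  have hAE : ∀ c z j, j ≠ v → j ≠ v' → ∀ b, A c (Function.update z j b) = A c z := by
    intro c z j h1 h2 b
    simp only [A, Function.update_comm h1, hψE c _ j h1 h2]
  have hAv : ∀ c z a, A c (Function.update z v a) = A c z := fun c z a => by simp [A]
  have k1 := sum_abs_perm_mean_le hθ tgt w hw0 hw1 hq hwq v {v, v'} (by simp) (by rw [hcard]; exact hE)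
    k (fun c z => ψ c z - A c z) (C := 2) (by norm_num)
    (fun c z => (abs_sub _ _).trans (by linarith [hψ1 c z, hA1 c z]))
    (fun c z j hj b => by
      simp only [Finset.mem_insert, Finset.mem_singleton, not_or] at hj
      simp only [hψE c z j hj.1 hj.2, hAE c z j hj.1 hj.2])
    (fun c z => by
      simp only [mul_sub, Finset.sum_sub_distrib, hAv]
      rw [← Finset.sum_mul, sum_bern, one_mul]
      exact sub_self _)
  have k2 := sum_abs_perm_mean_le hθ tgt w hw0 hw1 hq hwq v' {v, v'} (by simp) (by rw [hcard]; exact hE)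
    k A (C := 1) (by norm_num) hA1
    (fun c z j hj b => by
      simp only [Finset.mem_insert, Finset.mem_singleton, not_or] at hj
      exact hAE c z j hj.1 hj.2 b) hψ0
  rw [hcard] at k1 k2
  push_cast at k1 k2
  have e : (6 : ℝ) / √((Fintype.card U - 2 : ℝ) * q) =
      2 * 2 / √((Fintype.card U - 2 : ℝ) * q) + 2 * 1 / √((Fintype.card U - 2 : ℝ) * q) := by ring
  rw [e]
  refine le_trans ?_ (add_le_add k1 k2)
  rw [← Finset.sum_add_distrib]
  refine Finset.sum_le_sum fun y _ => ?_
  refine le_of_eq_of_le ?_ (abs_add_le _ _)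
  rw [← mul_add, ← Finset.sum_add_distrib]
  congr 2
  refine Finset.sum_congr rfl fun π _ => ?_
  rw [← Finset.sum_add_distrib]
  exact Finset.sum_congr rfl fun c _ => by ring

end Hiding

/-! ### Moving the parameter of a Bernoulli variable -/

/-- The probability of reporting `true` when `x` was observed, in the channel that turns a
Bernoulli(`s`) variable into a Bernoulli(`q`) variable with as few changes as possible. -/
def shift (s q : ℝ) (x : Bool) : ℝ := if x then min 1 (q / s) else max 0 ((q - s) / (1 - s))

theorem shift_mem_Icc {s q : ℝ} (hs : s ∈ Set.Icc (0 : ℝ) 1) (hq : q ∈ Set.Icc (0 : ℝ) 1)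
    (x : Bool) : shift s q x ∈ Set.Icc (0 : ℝ) 1 := by
  cases x
  · simp only [shift, Bool.false_eq_true, if_false]
    refine ⟨le_max_left _ _, max_le zero_le_one ?_⟩
    exact div_le_one_of_le₀ (by linarith [hq.2]) (by linarith [hs.2])
  · simp only [shift, if_true]
    exact ⟨le_min zero_le_one (div_nonneg hq.1 hs.1), min_le_left _ _⟩

/-- The state `true` keeps as much mass as the target admits. A zero denominator in `shift` is
harmless, as it is multiplied by zero mass. -/
theorem mul_shift_true {s q : ℝ} (hs : s ∈ Set.Icc (0 : ℝ) 1) (hq : q ∈ Set.Icc (0 : ℝ) 1) :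
    s * shift s q true = min s q := by
  rcases hs.1.eq_or_lt with rfl | h
  · simp [hq.1]
  · simp only [shift, if_true]
    rw [mul_min_of_nonneg _ _ h.le, mul_one, mul_div_cancel₀ _ h.ne']

theorem mul_shift_false {s q : ℝ} (hs : s ∈ Set.Icc (0 : ℝ) 1) (hq : q ∈ Set.Icc (0 : ℝ) 1) :
    (1 - s) * shift s q false = max 0 (q - s) := by
  have h0 : 0 ≤ 1 - s := by linarith [hs.2]
  rcases h0.eq_or_lt with h | h
  · rw [← h, zero_mul, max_eq_left]
    linarith [hq.2]
  · simp only [shift, Bool.false_eq_true, if_false]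
    rw [mul_max_of_nonneg _ _ h.le, mul_zero, mul_div_cancel₀ _ h.ne']

/-- The kept mass `min s q` and the moved mass `max 0 (q - s)` add up to `q`. -/
theorem sum_bern_shift {s q : ℝ} (hs : s ∈ Set.Icc (0 : ℝ) 1) (hq : q ∈ Set.Icc (0 : ℝ) 1)
    (z : Bool) : ∑ b, bern s b * bern (shift s q b) z = bern q z := by
  have h1 := mul_shift_true hs hq
  have h2 := mul_shift_false hs hq
  have h3 : min s q + max 0 (q - s) = q := by
    rcases le_total s q with h | h
    · rw [min_eq_left h, max_eq_right (by linarith)]; ring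
    · rw [min_eq_right h, max_eq_left (by linarith)]; ring
  cases z <;> simp only [Fintype.sum_bool, bern, Bool.false_eq_true, if_false, if_true] <;> linarith

/-- Mass moves in one direction only, so the flip probability is the total variation distance of the
two laws. -/
theorem sum_bern_shift_not {s q : ℝ} (hs : s ∈ Set.Icc (0 : ℝ) 1) (hq : q ∈ Set.Icc (0 : ℝ) 1) :
    ∑ b, bern s b * bern (shift s q b) (!b) = |s - q| := by
  have h1 := mul_shift_true hs hq
  have h2 := mul_shift_false hs hq
  have h3 : s - min s q + max 0 (q - s) = |s - q| := by
    rcases le_total s q with h | h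
    · rw [min_eq_left h, max_eq_right (by linarith), abs_of_nonpos (by linarith)]; ring
    · rw [min_eq_right h, max_eq_left (by linarith), abs_of_nonneg (by linarith)]; ring
  simp only [Fintype.sum_bool, bern, Bool.false_eq_true, if_false, if_true, Bool.not_true,
    Bool.not_false]
  linarith

/-! ### The grid of parameters -/

/-- The `j`-th point of the grid of mesh `1 / N` in `[0,1]`. -/
def gridPoint (N : ℕ) (j : Fin (N + 1)) : ℝ := (j : ℝ) / N

/-- The last grid point below `t`. -/
def gridFloor (N : ℕ) (t : ℝ) : Fin (N + 1) := ⟨min ⌊t * N⌋₊ N, by omega⟩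

theorem gridPoint_mem_Icc (N : ℕ) (j : Fin (N + 1)) : gridPoint N j ∈ Set.Icc (0 : ℝ) 1 := by
  refine ⟨by unfold gridPoint; positivity, div_le_one_of_le₀ ?_ (Nat.cast_nonneg _)⟩
  exact_mod_cast Nat.lt_succ_iff.1 j.2

theorem abs_sub_gridPoint_gridFloor_le {N : ℕ} (hN : 0 < N) {t : ℝ} (ht : t ∈ Set.Icc (0 : ℝ) 1) :
    |t - gridPoint N (gridFloor N t)| ≤ 1 / N := by
  have hN' : (0 : ℝ) < N := by exact_mod_cast hN
  have h0 : 0 ≤ t * N := mul_nonneg ht.1 hN'.le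
  -- For `t ≤ 1` the cap in `gridFloor` is inactive.
  have hle : ⌊t * N⌋₊ ≤ N := by
    apply Nat.floor_le_of_le
    nlinarith [ht.2]
  have e : t - gridPoint N (gridFloor N t) = (t * N - ⌊t * N⌋₊) / N := by
    simp only [gridPoint, gridFloor, min_eq_left hle]
    field_simp
  have h1 := Nat.floor_le h0
  have h2 := Nat.lt_floor_add_one (t * N)
  rw [e, abs_of_nonneg (div_nonneg (by linarith) hN'.le)]
  gcongr
  linarith

/-! ### The report probabilities of a pair -/

/-- The first marginal of `P`. -/
def fstProb (P : Bool × Bool → ℝ) (a : Bool) : ℝ := P (a, true) + P (a, false)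

/-- The probability that the second coordinate is `true` given that the first one is `a`. -/
def condProb (P : Bool × Bool → ℝ) (a : Bool) : ℝ := P (a, true) / fstProb P a

/-- The likelier value of the first coordinate. -/
def fstMode (P : Bool × Bool → ℝ) : Bool := decide (fstProb P false ≤ fstProb P true)

/-- The covariance of the two coordinates under `P`. -/
def pairCov (P : Bool × Bool → ℝ) : ℝ :=
  P (true, true) - fstProb P true * fstProb (P ∘ Prod.swap) true

/-- The labels of the parameters of the two reports if the first user keeps its sample up to
rounding, while the conditional law of the second sample given the first one is moved to its value
at the likelier value of the first sample. -/
def keepFstLabel (N : ℕ) (P : Bool × Bool → ℝ) : Fin (N + 1) × Fin (N + 1) :=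
  (gridFloor N (fstProb P true), gridFloor N (condProb P (fstMode P)))

/-- The probabilities of the two users reporting `true`, given the drawn labels `c` and the true
samples `x`, in the situation of `keepFstLabel`. -/
def keepFstParam (N : ℕ) (P : Bool × Bool → ℝ) (c : Option (Fin (N + 1)) × Option (Fin (N + 1)))
    (x : Bool × Bool) : ℝ × ℝ :=
  (c.1.elim (shift (fstProb P true) (gridPoint N (keepFstLabel N P).1) x.1) (gridPoint N),
    c.2.elim (shift (condProb P x.1) (gridPoint N (keepFstLabel N P).2) x.2) (gridPoint N))

/-- The first sample is at least as predictable as the second one. -/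
def KeepsFst (P : Bool × Bool → ℝ) : Prop :=
  max (fstProb (P ∘ Prod.swap) true) (fstProb (P ∘ Prod.swap) false) ≤
    max (fstProb P true) (fstProb P false)

open scoped Classical in
/-- The labels of the parameters of the reports of an associated pair. -/
def pairLabel (N : ℕ) (P : Bool × Bool → ℝ) : Fin (N + 1) × Fin (N + 1) :=
  if KeepsFst P then keepFstLabel N P else (keepFstLabel N (P ∘ Prod.swap)).swap

open scoped Classical in
/-- The probabilities of two associated users reporting `true`, given the drawn labels `c` and the
true samples `x`. -/
def pairParam (N : ℕ) (P : Bool × Bool → ℝ) (c : Option (Fin (N + 1)) × Option (Fin (N + 1)))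
    (x : Bool × Bool) : ℝ × ℝ :=
  if KeepsFst P then keepFstParam N P c x
  else (keepFstParam N (P ∘ Prod.swap) c.swap x.swap).swap

section Pair

variable {P : Bool × Bool → ℝ}

theorem sum_comp_swap (F : Bool × Bool → ℝ) : ∑ x, F (Prod.swap x) = ∑ x, F x :=
  Equiv.sum_comp (Equiv.prodComm Bool Bool) F

theorem fstProb_false (h1 : ∑ x, P x = 1) : fstProb P false = 1 - fstProb P true := by
  simp only [Fintype.sum_prod_type, Fintype.sum_bool] at h1
  simp only [fstProb]; linarith

theorem fstProb_eq_bern (h1 : ∑ x, P x = 1) (a : Bool) : fstProb P a = bern (fstProb P true) a := by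
  cases a
  · simp [bern, fstProb_false h1]
  · simp [bern]

theorem fstProb_nonneg (h0 : ∀ x, 0 ≤ P x) (a : Bool) : 0 ≤ fstProb P a :=
  add_nonneg (h0 _) (h0 _)

theorem fstProb_mem_Icc (h0 : ∀ x, 0 ≤ P x) (h1 : ∑ x, P x = 1) (a : Bool) :
    fstProb P a ∈ Set.Icc (0 : ℝ) 1 := by
  refine ⟨fstProb_nonneg h0 a, ?_⟩
  have h := fstProb_false h1
  have ht := fstProb_nonneg h0 true
  have hf := fstProb_nonneg h0 false
  cases a <;> linarith

theorem condProb_mem_Icc (h0 : ∀ x, 0 ≤ P x) (a : Bool) : condProb P a ∈ Set.Icc (0 : ℝ) 1 :=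
  ⟨div_nonneg (h0 _) (fstProb_nonneg h0 a),
    div_le_one_of_le₀ (by simp only [fstProb]; linarith [h0 (a, false)]) (fstProb_nonneg h0 a)⟩

/-- If the conditioning event is null, both sides vanish, so the default value of `condProb` does
not matter. -/
theorem fstProb_mul_condProb (h0 : ∀ x, 0 ≤ P x) (a : Bool) :
    fstProb P a * condProb P a = P (a, true) := by
  rcases (fstProb_nonneg h0 a).eq_or_lt with h | h
  · have h2 := h0 (a, true)
    have h3 := h0 (a, false)
    rw [← h, zero_mul]
    simp only [fstProb] at h
    linarith
  · rw [condProb, mul_div_cancel₀ _ h.ne']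

theorem eq_fstProb_mul_bern (h0 : ∀ x, 0 ≤ P x) (a b : Bool) :
    P (a, b) = fstProb P a * bern (condProb P a) b := by
  have h := fstProb_mul_condProb h0 a
  cases b
  · simp only [bern, Bool.false_eq_true, if_false]
    rw [mul_sub, h, mul_one]
    simp only [fstProb]; ring
  · simp only [bern, if_true, h]

theorem keepFstParam_mem_Icc (N : ℕ) (h0 : ∀ x, 0 ≤ P x) (h1 : ∑ x, P x = 1)
    (c : Option (Fin (N + 1)) × Option (Fin (N + 1))) (x : Bool × Bool) :
    (keepFstParam N P c x).1 ∈ Set.Icc (0 : ℝ) 1 ∧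
      (keepFstParam N P c x).2 ∈ Set.Icc (0 : ℝ) 1 := by
  obtain ⟨c1, c2⟩ := c
  constructor
  · cases c1
    · exact shift_mem_Icc (fstProb_mem_Icc h0 h1 _) (gridPoint_mem_Icc _ _) _
    · exact gridPoint_mem_Icc _ _
  · cases c2
    · exact shift_mem_Icc (condProb_mem_Icc h0 _) (gridPoint_mem_Icc _ _) _
    · exact gridPoint_mem_Icc _ _

/-- Given either value of the first sample, the second report has the same law. Summing over the
second sample first therefore leaves a factor free of `a`, and the sum over `a` gives the first
report. A drawn label ignores the samples and fits the same scheme. -/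
theorem sum_mul_bern_keepFstParam (N : ℕ) (h0 : ∀ x, 0 ≤ P x) (h1 : ∑ x, P x = 1)
    (c : Option (Fin (N + 1)) × Option (Fin (N + 1))) (z : Bool × Bool) :
    ∑ x, P x * (bern (keepFstParam N P c x).1 z.1 * bern (keepFstParam N P c x).2 z.2) =
      bern (gridPoint N (c.1.getD (keepFstLabel N P).1)) z.1 *
        bern (gridPoint N (c.2.getD (keepFstLabel N P).2)) z.2 := by
  obtain ⟨c1, c2⟩ := c
  have k1 : ∑ a, fstProb P a * bern (c1.elim (shift (fstProb P true)
      (gridPoint N (keepFstLabel N P).1) a) (gridPoint N)) z.1 =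
      bern (gridPoint N (c1.getD (keepFstLabel N P).1)) z.1 := by
    cases c1
    · refine (Finset.sum_congr rfl fun a _ => ?_).trans
        (sum_bern_shift (fstProb_mem_Icc h0 h1 true) (gridPoint_mem_Icc _ _) z.1)
      rw [fstProb_eq_bern h1 a]
      rfl
    · simp only [Option.elim_some, Option.getD_some]
      rw [← Finset.sum_mul, Fintype.sum_bool, fstProb_false h1]; ring
  have k2 : ∀ a, ∑ b, P (a, b) * bern (c2.elim (shift (condProb P a)
      (gridPoint N (keepFstLabel N P).2) b) (gridPoint N)) z.2 =
      fstProb P a * bern (gridPoint N (c2.getD (keepFstLabel N P).2)) z.2 := by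
    intro a
    cases c2
    · simp only [eq_fstProb_mul_bern h0 a, mul_assoc, ← Finset.mul_sum]
      congr 1
      exact sum_bern_shift (condProb_mem_Icc h0 _) (gridPoint_mem_Icc _ _) _
    · simp only [Option.elim_some, Option.getD_some]
      rw [← Finset.sum_mul, Fintype.sum_bool, fstProb]
  rw [Fintype.sum_prod_type, ← k1, Finset.sum_mul]
  refine Finset.sum_congr rfl fun a _ => ?_
  rw [mul_right_comm, ← k2, Finset.sum_mul]
  refine Finset.sum_congr rfl fun b _ => ?_
  simp only [keepFstParam]; ring

/-- The first sample is merely rounded, so its flips cost the distance to the grid. -/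
theorem sum_keepFstParam_fst_not_le {N : ℕ} (hN : 0 < N) (h0 : ∀ x, 0 ≤ P x) (h1 : ∑ x, P x = 1)
    (c : Option (Fin (N + 1)) × Option (Fin (N + 1))) (hc : c.1 = none) :
    ∑ x, P x * bern (keepFstParam N P c x).1 (!x.1) ≤ 1 / N := by
  have : ∑ x, P x * bern (keepFstParam N P c x).1 (!x.1) =
      |fstProb P true - gridPoint N (keepFstLabel N P).1| := by
    rw [← sum_bern_shift_not (fstProb_mem_Icc h0 h1 _) (gridPoint_mem_Icc _ _),
      Fintype.sum_prod_type]
    refine Finset.sum_congr rfl fun a _ => ?_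
    rw [← fstProb_eq_bern h1 a, Fintype.sum_bool]
    simp only [keepFstParam, hc, Option.elim_none]
    simp only [fstProb]; ring
  rw [this]
  exact abs_sub_gridPoint_gridFloor_le hN (fstProb_mem_Icc h0 h1 _)

theorem fstProb_fstMode (P : Bool × Bool → ℝ) :
    fstProb P (fstMode P) = max (fstProb P true) (fstProb P false) := by
  by_cases h : fstProb P false ≤ fstProb P true
  · simp [fstMode, h]
  · simp [fstMode, h, (not_le.1 h).le]

/-- This is where the covariance enters: it measures how far apart the two conditional laws of the
second sample are. -/
theorem abs_fstProb_mul_condProb_sub (h0 : ∀ x, 0 ≤ P x) (h1 : ∑ x, P x = 1) (a : Bool) :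
    fstProb P a * (fstProb P (!a) * |condProb P (!a) - condProb P a|) = |pairCov P| := by
  have ht := fstProb_mul_condProb h0 true
  have hf := fstProb_mul_condProb h0 false
  have hP := fstProb_false h1
  have e : pairCov P = fstProb P true * (fstProb P false * (condProb P true - condProb P false)) := by
    have : fstProb (P ∘ Prod.swap) true = P (true, true) + P (false, true) := rfl
    rw [pairCov, this, ← ht, ← hf, hP]; ring
  rw [e, abs_mul, abs_mul, abs_of_nonneg (fstProb_nonneg h0 _), abs_of_nonneg (fstProb_nonneg h0 _)]
  cases a
  · simp only [Bool.not_false]; ring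
  · simp only [Bool.not_true]; rw [abs_sub_comm]

/-- At the likelier first sample only rounding causes flips. At the other one the conditional
probability is moved by the gap between its two values, and the gap weighted by the probability of
that sample is |Cov| over the probability of the likelier one. -/
theorem sum_keepFstParam_snd_not_le {N : ℕ} (hN : 0 < N) (h0 : ∀ x, 0 ≤ P x) (h1 : ∑ x, P x = 1)
    (c : Option (Fin (N + 1)) × Option (Fin (N + 1))) (hc : c.2 = none) :
    ∑ x, P x * bern (keepFstParam N P c x).2 (!x.2) ≤
      |pairCov P| / max (fstProb P true) (fstProb P false) + 1 / N := by
  set q := gridPoint N (keepFstLabel N P).2 with hq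
  have e : ∑ x, P x * bern (keepFstParam N P c x).2 (!x.2) =
      ∑ a, fstProb P a * |condProb P a - q| := by
    rw [Fintype.sum_prod_type]
    refine Finset.sum_congr rfl fun a _ => ?_
    rw [← sum_bern_shift_not (condProb_mem_Icc h0 a) (gridPoint_mem_Icc _ _), Finset.mul_sum]
    refine Finset.sum_congr rfl fun b _ => ?_
    rw [← mul_assoc, ← eq_fstProb_mul_bern h0 a b]
    simp only [keepFstParam, hc, Option.elim_none]
  have hround : |condProb P (fstMode P) - q| ≤ 1 / N :=
    abs_sub_gridPoint_gridFloor_le hN (condProb_mem_Icc h0 _)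
  have hsplit : ∀ a : Bool, ∑ b, fstProb P b * |condProb P b - q| =
      fstProb P a * |condProb P a - q| + fstProb P (!a) * |condProb P (!a) - q| := by
    intro a; cases a <;> simp [add_comm]
  have hsum : ∀ a : Bool, fstProb P a + fstProb P (!a) = 1 := by
    intro a; have := fstProb_false h1; cases a <;> simp only [Bool.not_true, Bool.not_false] <;> linarith
  set t := fstMode P with ht
  have hcov := abs_fstProb_mul_condProb_sub h0 h1 t
  rw [e, hsplit t, ← fstProb_fstMode, ← ht]
  have hmode : 0 < fstProb P t := by
    have h2 := fstProb_fstMode P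
    have h3 := hsum true
    rw [← ht] at h2
    simp only [Bool.not_true] at h3
    have h4 := le_max_left (fstProb P true) (fstProb P false)
    have h5 := le_max_right (fstProb P true) (fstProb P false)
    linarith
  have k : fstProb P (!t) * |condProb P (!t) - condProb P t| = |pairCov P| / fstProb P t := by
    rw [eq_div_iff hmode.ne', mul_comm, hcov]
  have tri := abs_sub_le (condProb P (!t)) (condProb P t) q
  have n1 := fstProb_nonneg h0 t
  have n2 := fstProb_nonneg h0 (!t)
  have h3 := hsum t
  calc _ ≤ fstProb P t * (1 / N) +
      fstProb P (!t) * (|condProb P (!t) - condProb P t| + 1 / N) := by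
        gcongr
        linarith
    _ = |pairCov P| / fstProb P t + (fstProb P t + fstProb P (!t)) * (1 / N) := by
        rw [mul_add, k]; ring
    _ = _ := by rw [h3, one_mul]

theorem pairParam_mem_Icc (N : ℕ) (h0 : ∀ x, 0 ≤ P x) (h1 : ∑ x, P x = 1)
    (c : Option (Fin (N + 1)) × Option (Fin (N + 1))) (x : Bool × Bool) :
    (pairParam N P c x).1 ∈ Set.Icc (0 : ℝ) 1 ∧ (pairParam N P c x).2 ∈ Set.Icc (0 : ℝ) 1 := by
  unfold pairParam
  split_ifs
  · exact keepFstParam_mem_Icc N h0 h1 c x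
  · exact (keepFstParam_mem_Icc N (P := P ∘ Prod.swap) (fun _ => h0 _)
      ((sum_comp_swap P).trans h1) _ _).symm

/-- The reports of an associated pair are independent with parameters on the grid. -/
theorem sum_mul_bern_pairParam (N : ℕ) (h0 : ∀ x, 0 ≤ P x) (h1 : ∑ x, P x = 1)
    (c : Option (Fin (N + 1)) × Option (Fin (N + 1))) (z : Bool × Bool) :
    ∑ x, P x * (bern (pairParam N P c x).1 z.1 * bern (pairParam N P c x).2 z.2) =
      bern (gridPoint N (c.1.getD (pairLabel N P).1)) z.1 *
        bern (gridPoint N (c.2.getD (pairLabel N P).2)) z.2 := by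
  by_cases hk : KeepsFst P
  · simp only [pairParam, pairLabel, if_pos hk]
    exact sum_mul_bern_keepFstParam N h0 h1 c z
  · simp only [pairParam, pairLabel, if_neg hk]
    have := sum_mul_bern_keepFstParam N (P := P ∘ Prod.swap) (fun _ => h0 _)
      ((sum_comp_swap P).trans h1) c.swap z.swap
    rw [mul_comm] at this
    simp only [Prod.fst_swap, Prod.snd_swap] at this ⊢
    rw [← this, ← sum_comp_swap]
    refine Finset.sum_congr rfl fun x _ => ?_
    simp only [Function.comp, Prod.swap_swap]
    ring

/-- The denominator is the largest of the four state probabilities, and `KeepsFst` decides whether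
the first user attains it. The more predictable user is the one kept, so its partner's flips come
with exactly this denominator; the kept user needs only the `1 / N`. -/
theorem sum_pairParam_not_le {N : ℕ} (hN : 0 < N) (h0 : ∀ x, 0 ≤ P x) (h1 : ∑ x, P x = 1)
    (c : Option (Fin (N + 1)) × Option (Fin (N + 1))) :
    (c.1 = none → ∑ x, P x * bern (pairParam N P c x).1 (!x.1) ≤
      |pairCov P| / max (max (fstProb P true) (fstProb (P ∘ Prod.swap) true))
        (max (1 - fstProb P true) (1 - fstProb (P ∘ Prod.swap) true)) + 1 / N) ∧
    (c.2 = none → ∑ x, P x * bern (pairParam N P c x).2 (!x.2) ≤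
      |pairCov P| / max (max (fstProb P true) (fstProb (P ∘ Prod.swap) true))
        (max (1 - fstProb P true) (1 - fstProb (P ∘ Prod.swap) true)) + 1 / N) := by
  have h0' : ∀ x, 0 ≤ (P ∘ Prod.swap) x := fun _ => h0 _
  have h1' : ∑ x, (P ∘ Prod.swap) x = 1 := (sum_comp_swap P).trans h1
  rw [← fstProb_false h1, ← fstProb_false h1', max_max_max_comm]
  have hm : 0 ≤ max (max (fstProb P true) (fstProb P false))
      (max (fstProb (P ∘ Prod.swap) true) (fstProb (P ∘ Prod.swap) false)) :=
    le_max_of_le_left (le_max_of_le_left (fstProb_nonneg h0 _))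
  have hnn := div_nonneg (abs_nonneg (pairCov P)) hm
  by_cases hk : KeepsFst P
  · simp only [pairParam, if_pos hk]
    refine ⟨fun hc => ?_, fun hc => ?_⟩
    · linarith [sum_keepFstParam_fst_not_le hN h0 h1 c hc]
    · rw [max_eq_left hk]
      exact sum_keepFstParam_snd_not_le hN h0 h1 c hc
  · simp only [pairParam, if_neg hk]
    have hcov : pairCov (P ∘ Prod.swap) = pairCov P := by
      have : (P ∘ Prod.swap) ∘ Prod.swap = P := by funext x; simp
      rw [pairCov, pairCov, this]
      simp only [Function.comp, Prod.swap]; ring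
    have k1 := sum_keepFstParam_fst_not_le hN h0' h1' c.swap
    have k2 := sum_keepFstParam_snd_not_le hN h0' h1' c.swap
    rw [hcov] at k2
    refine ⟨fun hc => ?_, fun hc => ?_⟩
    · rw [max_eq_right (not_le.1 hk).le]
      refine le_of_eq_of_le ?_ (k2 hc)
      rw [← sum_comp_swap]
      rfl
    · refine le_of_eq_of_le ?_ ((k1 hc).trans (le_add_of_nonneg_left hnn))
      rw [← sum_comp_swap]
      rfl

end Pair

/-! ### Labels drawn from seeds -/

/-- The label encoded by a natural number. -/
def cellLabel (N i : ℕ) : Option (Fin (N + 1)) := if h : i < N + 1 then some ⟨i, h⟩ else none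

/-- The label drawn by a user with noise parameter `r`: each of the `N + 1` labels is drawn with
probability `1 / (N + 1) ^ 2`, and otherwise there is none. -/
def seedLabel (N : ℕ) (r : Seed) : Option (Fin (N + 1)) :=
  cellLabel N ⌊(r : ℝ) * ((N : ℝ) + 1) ^ 2⌋₊

/-- The law of `seedLabel N`. -/
def labelWeight (N : ℕ) (a : Option (Fin (N + 1))) : ℝ :=
  (volume : Measure Seed).real (seedLabel N ⁻¹' {a})

theorem measurable_seedCell (N : ℕ) :
    Measurable fun r : Seed => ⌊(r : ℝ) * ((N : ℝ) + 1) ^ 2⌋₊ :=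
  Nat.measurable_floor.comp (measurable_subtype_coe.mul_const _)

theorem measurableSet_seedLabel (N : ℕ) (a : Option (Fin (N + 1))) :
    MeasurableSet (seedLabel N ⁻¹' {a}) :=
  measurable_seedCell N (MeasurableSet.of_discrete (s := cellLabel N ⁻¹' {a}))

/-- A label is read off a natural number, and every function on `ℕ` is measurable. -/
theorem measurable_comp_seedLabel {β : Type*} [MeasurableSpace β] (N : ℕ)
    (F : Option (Fin (N + 1)) → β) : Measurable fun r => F (seedLabel N r) :=
  (measurable_from_nat (f := fun i => F (cellLabel N i))).comp (measurable_seedCell N)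

theorem measurable_comp_seedLabel_prod {β : Type*} [MeasurableSpace β] (N : ℕ)
    (F : Option (Fin (N + 1)) × Option (Fin (N + 1)) → β) :
    Measurable fun r : Seed × Seed => F (seedLabel N r.1, seedLabel N r.2) :=
  (measurable_of_countable fun i : ℕ × ℕ => F (cellLabel N i.1, cellLabel N i.2)).comp
    (((measurable_seedCell N).comp measurable_fst).prodMk
      ((measurable_seedCell N).comp measurable_snd))

theorem labelWeight_nonneg (N : ℕ) (a : Option (Fin (N + 1))) : 0 ≤ labelWeight N a :=
  measureReal_nonneg

theorem sum_labelWeight (N : ℕ) : ∑ a, labelWeight N a = 1 := by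
  have h := measureReal_biUnion_finset (μ := (volume : Measure Seed))
    (s := (Finset.univ : Finset (Option (Fin (N + 1))))) (f := fun a => seedLabel N ⁻¹' {a})
    (fun a _ b _ hab => Disjoint.preimage _ (by simpa using hab))
    (fun a _ => measurableSet_seedLabel N a)
  have hu : (⋃ a ∈ (Finset.univ : Finset (Option (Fin (N + 1)))), seedLabel N ⁻¹' {a}) =
      Set.univ := by
    ext r; simp
  rw [hu] at h
  simpa [labelWeight] using h.symm

theorem labelWeight_some (N : ℕ) (j : Fin (N + 1)) :
    labelWeight N (some j) = 1 / ((N : ℝ) + 1) ^ 2 := by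
  have hpos : (0 : ℝ) < ((N : ℝ) + 1) ^ 2 := by positivity
  have hj : (j : ℝ) + 1 ≤ ((N : ℝ) + 1) ^ 2 := by
    have : (j : ℝ) + 1 ≤ (N : ℝ) + 1 := by exact_mod_cast j.2
    nlinarith [Nat.cast_nonneg (α := ℝ) N]
  have hj0 : (0 : ℝ) ≤ j := Nat.cast_nonneg _
  -- Label `j` is drawn on the cell from `j / (N + 1) ^ 2` to `(j + 1) / (N + 1) ^ 2`; the first `N
  -- + 1` of the `(N + 1) ^ 2` cells are used.
  let a : Seed := ⟨j / ((N : ℝ) + 1) ^ 2, by positivity,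
    div_le_one_of_le₀ (by linarith) hpos.le⟩
  let b : Seed := ⟨(j + 1) / ((N : ℝ) + 1) ^ 2, by positivity, div_le_one_of_le₀ hj hpos.le⟩
  have e : seedLabel N ⁻¹' {some j} = Set.Ico a b := by
    ext r
    have h0 : 0 ≤ (r : ℝ) * ((N : ℝ) + 1) ^ 2 := mul_nonneg r.2.1 hpos.le
    have h1 : r ∈ seedLabel N ⁻¹' {some j} ↔ ⌊(r : ℝ) * ((N : ℝ) + 1) ^ 2⌋₊ = j := by
      simp only [Set.mem_preimage, Set.mem_singleton_iff, seedLabel, cellLabel]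
      split_ifs with h
      · simp [Fin.ext_iff]
      · simp only [false_iff]
        have := j.2
        omega
    rw [h1, Nat.floor_eq_iff h0, Set.mem_Ico, ← Subtype.coe_le_coe, ← Subtype.coe_lt_coe]
    simp only [a, b]
    rw [div_le_iff₀ hpos, lt_div_iff₀ hpos]
  rw [labelWeight, e, measureReal_def, unitInterval.volume_Ico]
  simp only [a, b]
  rw [ENNReal.toReal_ofReal (by rw [sub_nonneg]; gcongr; linarith)]
  ring

/-- Independent seeds give independent labels: each label configuration is a product event. -/
theorem integral_seedLabel {U : Type*} [Fintype U] [DecidableEq U] (N : ℕ)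
    (F : (U → Option (Fin (N + 1))) → ℝ) :
    ∫ r : U → Seed, F (fun v => seedLabel N (r v)) = prodMean (fun _ => labelWeight N) F := by
  let A : (U → Option (Fin (N + 1))) → Set (U → Seed) := fun c =>
    Set.univ.pi fun v => seedLabel N ⁻¹' {c v}
  have hA : ∀ c, MeasurableSet (A c) := fun c =>
    MeasurableSet.univ_pi fun v => measurableSet_seedLabel N _
  have e : ∀ r : U → Seed, F (fun v => seedLabel N (r v)) =
      ∑ c, (A c).indicator (fun _ => F c) r := by
    intro r
    rw [Finset.sum_eq_single_of_mem (fun v => seedLabel N (r v)) (Finset.mem_univ _)]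
    · rw [Set.indicator_of_mem]
      simp [A]
    · intro c _ hc
      rw [Set.indicator_of_notMem]
      intro h
      apply hc
      funext v
      have := h v (Set.mem_univ v)
      simpa using this.symm
  simp only [e]
  rw [integral_finsetSum _ fun c _ => (integrable_const _).indicator (hA c), prodMean]
  refine Finset.sum_congr rfl fun c _ => ?_
  rw [integral_indicator_const _ (hA c), smul_eq_mul]
  congr 1
  rw [measureReal_def, volume_pi_pi, ENNReal.toReal_prod]
  rfl

/-! ### The obfuscation scheme -/

theorem sum_ofReal_bern {t : ℝ} (ht : t ∈ Set.Icc (0 : ℝ) 1) :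
    ∑ b, ENNReal.ofReal (bern t b) = 1 := by
  rw [← ENNReal.ofReal_sum_of_nonneg fun b _ => bern_nonneg ht b, sum_bern, ENNReal.ofReal_one]

theorem sum_ofReal_bern_mul {s t : ℝ} (hs : s ∈ Set.Icc (0 : ℝ) 1) (ht : t ∈ Set.Icc (0 : ℝ) 1) :
    ∑ b : Bool × Bool, ENNReal.ofReal (bern s b.1 * bern t b.2) = 1 := by
  rw [← ENNReal.ofReal_sum_of_nonneg fun b _ => mul_nonneg (bern_nonneg hs _) (bern_nonneg ht _),
    Fintype.sum_prod_type]
  simp only [← Finset.mul_sum, sum_bern, mul_one, ENNReal.ofReal_one]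

/-- The Bernoulli law with parameter `t` clamped to `[0,1]`. -/
def bernPMF (t : ℝ) : PMF Bool :=
  PMF.ofFintype (fun b => ENNReal.ofReal (bern (Set.projIcc (0 : ℝ) 1 zero_le_one t) b))
    (sum_ofReal_bern (Subtype.coe_prop _))

/-- The product of two Bernoulli laws with parameters clamped to `[0,1]`. -/
def bernPairPMF (t : ℝ × ℝ) : PMF (Bool × Bool) :=
  PMF.ofFintype (fun b => ENNReal.ofReal
      (bern (Set.projIcc (0 : ℝ) 1 zero_le_one t.1) b.1 *
        bern (Set.projIcc (0 : ℝ) 1 zero_le_one t.2) b.2))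
    (sum_ofReal_bern_mul (Subtype.coe_prop _) (Subtype.coe_prop _))

theorem toReal_bernPMF {t : ℝ} (ht : t ∈ Set.Icc (0 : ℝ) 1) (b : Bool) :
    (bernPMF t b).toReal = bern t b := by
  rw [bernPMF, PMF.ofFintype_apply, Set.projIcc_of_mem _ ht, ENNReal.toReal_ofReal (bern_nonneg ht b)]

theorem toReal_bernPairPMF {t : ℝ × ℝ} (h1 : t.1 ∈ Set.Icc (0 : ℝ) 1)
    (h2 : t.2 ∈ Set.Icc (0 : ℝ) 1) (b : Bool × Bool) :
    (bernPairPMF t b).toReal = bern t.1 b.1 * bern t.2 b.2 := by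
  rw [bernPairPMF, PMF.ofFintype_apply, Set.projIcc_of_mem _ h1, Set.projIcc_of_mem _ h2,
    ENNReal.toReal_ofReal (mul_nonneg (bern_nonneg h1 _) (bern_nonneg h2 _))]

/-- The probability that an isolated user with parameter `s`, drawn label `c` and true sample `x`
reports `true`. -/
def soloParam (N : ℕ) (s : ℝ) (c : Option (Fin (N + 1))) (x : Bool) : ℝ :=
  c.elim (shift s (gridPoint N (gridFloor N s)) x) (gridPoint N)

theorem soloParam_mem_Icc (N : ℕ) {s : ℝ} (hs : s ∈ Set.Icc (0 : ℝ) 1)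
    (c : Option (Fin (N + 1))) (x : Bool) : soloParam N s c x ∈ Set.Icc (0 : ℝ) 1 := by
  cases c
  · exact shift_mem_Icc hs (gridPoint_mem_Icc _ _) x
  · exact gridPoint_mem_Icc _ _

theorem sum_bern_soloParam (N : ℕ) {s : ℝ} (hs : s ∈ Set.Icc (0 : ℝ) 1)
    (c : Option (Fin (N + 1))) (z : Bool) :
    ∑ a, bern s a * bern (soloParam N s c a) z =
      bern (gridPoint N (c.getD (gridFloor N s))) z := by
  cases c
  · exact sum_bern_shift hs (gridPoint_mem_Icc _ _) z
  · simp only [soloParam, Option.elim_some, Option.getD_some]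
    rw [← Finset.sum_mul, sum_bern, one_mul]

/-- The number of mesh cells of the parameter grid for `n` users. -/
def gridSize (n : ℕ) : ℕ := n.sqrt.sqrt + 1

/-- Users round the parameters of their samples to a grid, associated users after decorrelating
their samples; with vanishing probability a user reports pure noise with a random parameter on the
grid instead. -/
def roundingScheme : ObfuscationScheme where
  solo n ν r x := bernPMF (soloParam (gridSize n) (ν.real {true}) (seedLabel (gridSize n) r) x)
  pair n ν r x := bernPairPMF (pairParam (gridSize n) (fun a => ν.real {a})
    (seedLabel (gridSize n) r.1, seedLabel (gridSize n) r.2) x)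
  measurable_solo n ν x z := measurable_comp_seedLabel (gridSize n)
    fun c => bernPMF (soloParam (gridSize n) (ν.real {true}) c x) z
  measurable_pair n ν x z := measurable_comp_seedLabel_prod (gridSize n)
    fun c => bernPairPMF (pairParam (gridSize n) (fun a => ν.real {a}) c x) z

/-! ### The groups of users in the system -/

section Components

variable {G : SimpleGraph ℕ} (hG : ∀ C : G.ConnectedComponent, C.supp.encard ≤ 2)
include hG

theorem eq_of_mem_supp {C : G.ConnectedComponent} {u v w : ℕ} (hu : u ∈ C.supp) (hv : v ∈ C.supp)
    (hw : w ∈ C.supp) (huv : u ≠ v) (huw : u ≠ w) : v = w := by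
  by_contra hvw
  have h : ({u, v, w} : Set ℕ) ⊆ C.supp := by
    rintro t (rfl | rfl | rfl) <;> assumption
  have h3 : ({u, v, w} : Set ℕ).encard = 3 := Set.encard_eq_three.2 ⟨u, v, w, huv, huw, hvw, rfl⟩
  have := (Set.encard_le_encard h).trans (hG C)
  rw [h3] at this
  exact absurd this (by decide)

theorem eq_of_adj_of_adj {u v w : ℕ} (h1 : G.Adj u v) (h2 : G.Adj u w) : v = w := by
  refine eq_of_mem_supp hG (C := G.connectedComponentMk u) (u := u) rfl ?_ ?_ h1.ne h2.ne
  · exact (SimpleGraph.ConnectedComponent.sound h1.reachable).symm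
  · exact (SimpleGraph.ConnectedComponent.sound h2.reachable).symm

/-- In a group of at most two, the first step of a walk between distinct members already reaches the
end. -/
theorem adj_of_connectedComponentMk_eq {u v : ℕ} (huv : u ≠ v)
    (h : G.connectedComponentMk u = G.connectedComponentMk v) : G.Adj u v := by
  obtain ⟨W⟩ := SimpleGraph.ConnectedComponent.exact h
  cases W with
  | nil => exact absurd rfl huv
  | @cons _ w _ hw W' =>
    have : w = v := eq_of_mem_supp hG (C := G.connectedComponentMk u) (u := u) rfl
      (SimpleGraph.ConnectedComponent.sound hw.reachable).symm h.symm hw.ne huv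
    exact this ▸ hw

end Components

/-- The users without an associate in the system of `n` users. -/
abbrev SoloUser (G : SimpleGraph ℕ) (n : ℕ) := {u : Fin n // ∀ v : Fin n, ¬ G.Adj u v}

/-- The associated pairs in the system of `n` users. -/
abbrev UserPair (G : SimpleGraph ℕ) (n : ℕ) :=
  {e : Fin n × Fin n // e.1 < e.2 ∧ G.Adj e.1 e.2}

instance (G : SimpleGraph ℕ) (n : ℕ) : Fintype (SoloUser G n) := Fintype.ofFinite _

instance (G : SimpleGraph ℕ) (n : ℕ) : Fintype (UserPair G n) := Fintype.ofFinite _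

section Groups

variable {G : SimpleGraph ℕ} (hG : ∀ C : G.ConnectedComponent, C.supp.encard ≤ 2) (n : ℕ)

/-- The member of a group. -/
def groupMember (G : SimpleGraph ℕ) (n : ℕ) : SoloUser G n ⊕ (UserPair G n ⊕ UserPair G n) → Fin n :=
  Sum.elim (fun a => a.1) (Sum.elim (fun e => e.1.1) fun e => e.1.2)

-- As groups have at most two members, every user is isolated or belongs to exactly one pair, as its
-- lower or its upper member.
include hG in
theorem bijective_groupMember : Function.Bijective (groupMember G n) := by
  constructor
  · rintro (⟨a, ha⟩ | ⟨⟨e1, e2⟩, he⟩ | ⟨⟨e1, e2⟩, he⟩) (⟨b, hb⟩ | ⟨⟨f1, f2⟩, hf⟩ | ⟨⟨f1, f2⟩, hf⟩) h <;>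
      simp only [groupMember, Sum.elim_inl, Sum.elim_inr] at h <;> subst h
    · rfl
    · exact absurd hf.2 (ha _)
    · exact absurd hf.2.symm (ha _)
    · exact absurd he.2 (hb _)
    · have : e2 = f2 := Fin.ext (eq_of_adj_of_adj hG he.2 hf.2)
      subst this; rfl
    · have : e2 = f1 := Fin.ext (eq_of_adj_of_adj hG he.2 hf.2.symm)
      subst this
      exact absurd (he.1.trans hf.1) (lt_irrefl _)
    · exact absurd he.2.symm (hb _)
    · have : e1 = f2 := Fin.ext (eq_of_adj_of_adj hG he.2.symm hf.2)
      subst this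
      exact absurd (he.1.trans hf.1) (lt_irrefl _)
    · have : e1 = f1 := Fin.ext (eq_of_adj_of_adj hG he.2.symm hf.2.symm)
      subst this; rfl
  · intro u
    by_cases h : ∀ v : Fin n, ¬ G.Adj u v
    · exact ⟨.inl ⟨u, h⟩, rfl⟩
    · push Not at h
      obtain ⟨v, hv⟩ := h
      rcases lt_trichotomy u v with h | h | h
      · exact ⟨.inr (.inl ⟨(u, v), h, hv⟩), rfl⟩
      · exact absurd (congrArg Fin.val h) hv.ne
      · exact ⟨.inr (.inr ⟨(v, u), h, hv.symm⟩), rfl⟩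

/-- The users of the system, sorted by groups. -/
def groupEquiv : SoloUser G n ⊕ (UserPair G n ⊕ UserPair G n) ≃ Fin n :=
  Equiv.ofBijective _ (bijective_groupMember hG n)

theorem groupEquiv_solo (a : SoloUser G n) : groupEquiv hG n (.inl a) = a.1 := rfl
theorem groupEquiv_fst (e : UserPair G n) : groupEquiv hG n (.inr (.inl e)) = e.1.1 := rfl
theorem groupEquiv_snd (e : UserPair G n) : groupEquiv hG n (.inr (.inr e)) = e.1.2 := rfl

theorem groupEquiv_symm_solo (a : SoloUser G n) : (groupEquiv hG n).symm a.1 = .inl a := by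
  rw [Equiv.symm_apply_eq, groupEquiv_solo]

theorem groupEquiv_symm_fst (e : UserPair G n) :
    (groupEquiv hG n).symm e.1.1 = .inr (.inl e) := by
  rw [Equiv.symm_apply_eq, groupEquiv_fst]

theorem groupEquiv_symm_snd (e : UserPair G n) :
    (groupEquiv hG n).symm e.1.2 = .inr (.inr e) := by
  rw [Equiv.symm_apply_eq, groupEquiv_snd]

include hG in
theorem prod_eq_prod_groups (F : Fin n → ℝ) :
    ∏ v, F v = (∏ a : SoloUser G n, F a.1) * ∏ e : UserPair G n, F e.1.1 * F e.1.2 := by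
  rw [← (groupEquiv hG n).prod_comp, Fintype.prod_sum_type, Fintype.prod_sum_type,
    Finset.prod_mul_distrib]
  rfl

-- A row of samples amounts to a free choice of values for the isolated users and for the pairs.
include hG in
theorem sum_mul_groups (H₁ : (SoloUser G n → Bool) → ℝ) (H₂ : (UserPair G n → Bool × Bool) → ℝ) :
    ∑ x : Fin n → Bool, H₁ (fun a => x a.1) * H₂ (fun e => (x e.1.1, x e.1.2)) =
      (∑ y, H₁ y) * ∑ y, H₂ y := by
  rw [Finset.sum_mul_sum, ← Fintype.sum_prod_type']
  refine Fintype.sum_equiv (((Equiv.arrowCongr (groupEquiv hG n).symm (Equiv.refl Bool)).trans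
    (Equiv.sumArrowEquivProdArrow _ _ _)).trans ((Equiv.refl _).prodCongr
      ((Equiv.sumArrowEquivProdArrow _ _ _).trans
        (Equiv.arrowProdEquivProdArrow _ _ _).symm))) _ _ fun x => ?_
  rfl

end Groups

/-! ### The law of one data sample -/

/-- The joint probability mass function of the samples of `u` and `v`. -/
def pairLaw (Q : Measure (ℕ → Bool)) (u v : ℕ) (a : Bool × Bool) : ℝ :=
  (Q.map fun w => (w u, w v)).real {a}

/-- The probability mass function of the samples of the first `n` users. -/
def rowLaw (Q : Measure (ℕ → Bool)) (n : ℕ) (x : Fin n → Bool) : ℝ :=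
  Q.real {w | ∀ u : Fin n, w u = x u}

section Law

variable {p : ℕ → ℝ} {G : SimpleGraph ℕ} {Q : Measure (ℕ → Bool)}

theorem measurable_pair_apply (u v : ℕ) : Measurable fun w : ℕ → Bool => (w u, w v) :=
  (measurable_pi_apply u).prodMk (measurable_pi_apply v)

theorem measurableSet_apply_eq (u : ℕ) (b : Bool) : MeasurableSet {w : ℕ → Bool | w u = b} :=
  measurableSet_eq_fun (measurable_pi_apply u) measurable_const

theorem pairLaw_eq (u v : ℕ) (a : Bool × Bool) :
    pairLaw Q u v a = Q.real {w | w u = a.1 ∧ w v = a.2} := by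
  rw [pairLaw, map_measureReal_apply (measurable_pair_apply u v) (measurableSet_singleton _)]
  congr 1
  ext w
  simp [Prod.ext_iff]

theorem pairLaw_nonneg (u v : ℕ) (a : Bool × Bool) : 0 ≤ pairLaw Q u v a := measureReal_nonneg

theorem rowLaw_nonneg (n : ℕ) (x : Fin n → Bool) : 0 ≤ rowLaw Q n x := measureReal_nonneg

theorem sum_rowLaw_mul [IsProbabilityMeasure Q] (n : ℕ) (F : (Fin n → Bool) → ℝ) :
    ∑ x, rowLaw Q n x * F x = ∫ w, F (fun u => w u) ∂Q := by
  have hm : Measurable fun (w : ℕ → Bool) (u : Fin n) => w u :=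
    measurable_pi_lambda _ fun u => measurable_pi_apply _
  have := Measure.isProbabilityMeasure_map (μ := Q) hm.aemeasurable
  rw [← integral_map (φ := fun (w : ℕ → Bool) (u : Fin n) => w u) hm.aemeasurable
    (measurable_of_finite F).aestronglyMeasurable, integral_fintype Integrable.of_finite]
  refine Finset.sum_congr rfl fun x _ => ?_
  rw [map_measureReal_apply hm (measurableSet_singleton _), smul_eq_mul, rowLaw]
  congr 3
  ext w
  simp [funext_iff]

theorem sum_pairLaw_mul [IsProbabilityMeasure Q] (u v : ℕ) (F : Bool × Bool → ℝ) :
    ∑ a, pairLaw Q u v a * F a = ∫ w, F (w u, w v) ∂Q := by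
  have hm := measurable_pair_apply u v
  have := Measure.isProbabilityMeasure_map (μ := Q) hm.aemeasurable
  rw [← integral_map (φ := fun w : ℕ → Bool => (w u, w v)) hm.aemeasurable
    (measurable_of_finite F).aestronglyMeasurable, integral_fintype Integrable.of_finite]
  rfl

theorem sum_pairLaw [IsProbabilityMeasure Q] (u v : ℕ) : ∑ a, pairLaw Q u v a = 1 := by
  simpa using sum_pairLaw_mul (Q := Q) u v fun _ => 1

theorem pairLaw_comp_swap (u v : ℕ) : pairLaw Q u v ∘ Prod.swap = pairLaw Q v u := by
  funext a
  simp only [Function.comp, pairLaw_eq, Prod.fst_swap, Prod.snd_swap, and_comm]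

namespace IsTwoStateLaw

variable (hQ : IsTwoStateLaw p G Q)
include hQ

theorem param_mem_Icc (u : ℕ) : p u ∈ Set.Icc (0 : ℝ) 1 := by
  have := hQ.isProb
  rw [← hQ.bernoulli u]
  exact ⟨measureReal_nonneg, measureReal_le_one⟩

theorem real_apply_eq (u : ℕ) (b : Bool) : Q.real {w | w u = b} = bern (p u) b := by
  have := hQ.isProb
  cases b
  · have h2 := probReal_compl_eq_one_sub (μ := Q) (measurableSet_apply_eq u true)
    rw [hQ.bernoulli] at h2
    simp only [bern, Bool.false_eq_true, if_false, ← h2]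
    congr 1
    ext w; simp
  · simpa [bern] using hQ.bernoulli u

theorem fstProb_pairLaw (u v : ℕ) (b : Bool) : fstProb (pairLaw Q u v) b = bern (p u) b := by
  have := hQ.isProb
  rw [← hQ.real_apply_eq, fstProb, pairLaw_eq, pairLaw_eq, ← measureReal_union]
  · congr 1
    ext w
    cases h : w v <;> simp [h]
  · rw [Set.disjoint_left]
    rintro w ⟨_, h1⟩ ⟨_, h2⟩
    simp only [h1] at h2
    exact absurd h2 (by decide)
  · exact (measurableSet_apply_eq u b).inter (measurableSet_apply_eq v false)

theorem integral_apply (u : ℕ) (F : Bool → ℝ) : ∫ w, F (w u) ∂Q = ∑ b, bern (p u) b * F b := by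
  have := hQ.isProb
  rw [← sum_pairLaw_mul u u fun a => F a.1, Fintype.sum_prod_type]
  refine Finset.sum_congr rfl fun b _ => ?_
  rw [← hQ.fstProb_pairLaw u u, fstProb, Fintype.sum_bool]
  ring

theorem pairCov_pairLaw (u v : ℕ) : pairCov (pairLaw Q u v) = sampleCov Q u v := by
  have := hQ.isProb
  have hb : ∀ u, MemLp (fun w : ℕ → Bool => if w u then (1 : ℝ) else 0) 2 Q := by
    intro u
    refine MemLp.of_bound (C := 1) ?_ (ae_of_all _ fun w => ?_)
    · exact ((measurable_of_finite fun b : Bool => if b then (1 : ℝ) else 0).comp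
        (measurable_pi_apply u)).aestronglyMeasurable
    · split_ifs <;> simp
  rw [sampleCov, covariance_eq_sub (hb u) (hb v), pairCov, pairLaw_comp_swap,
    hQ.integral_apply u fun b => if b then (1 : ℝ) else 0,
    hQ.integral_apply v fun b => if b then (1 : ℝ) else 0, hQ.fstProb_pairLaw, hQ.fstProb_pairLaw]
  have := sum_pairLaw_mul (Q := Q) u v fun a => (if a.1 then (1 : ℝ) else 0) * if a.2 then 1 else 0
  simp only [Pi.mul_apply, ← this]
  simp [Fintype.sum_prod_type]

/-- The groups are independent. -/
theorem rowLaw_eq_prod (hG : ∀ C : G.ConnectedComponent, C.supp.encard ≤ 2) (n : ℕ)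
    (x : Fin n → Bool) :
    rowLaw Q n x = (∏ a : SoloUser G n, bern (p a.1) (x a.1)) *
      ∏ e : UserPair G n, pairLaw Q e.1.1 e.1.2 (x e.1.1, x e.1.2) := by
  -- The component may contain an associate outside the system, on which the event below puts no
  -- constraint. Injectivity holds because distinct users of one component are adjacent.
  let κ : SoloUser G n ⊕ UserPair G n → G.ConnectedComponent :=
    Sum.elim (fun a => G.connectedComponentMk a.1) fun e => G.connectedComponentMk e.1.1
  have hadj : ∀ {u v : ℕ}, u ≠ v → G.connectedComponentMk u = G.connectedComponentMk v →
      G.Adj u v := adj_of_connectedComponentMk_eq hG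
  have hκ : Function.Injective κ := by
    rintro (⟨a, ha⟩ | ⟨⟨e1, e2⟩, he⟩) (⟨b, hb⟩ | ⟨⟨f1, f2⟩, hf⟩) h <;>
      simp only [κ, Sum.elim_inl, Sum.elim_inr] at h
    · by_cases hab : a = b
      · subst hab; rfl
      · exact absurd (hadj (fun h => hab (Fin.ext h)) h) (ha b)
    · by_cases hab : a = f1
      · subst hab; exact absurd hf.2 (ha _)
      · exact absurd (hadj (fun h => hab (Fin.ext h)) h) (ha _)
    · by_cases hab : b = e1
      · subst hab; exact absurd he.2 (hb _)
      · exact absurd (hadj (fun h => hab (Fin.ext h)) h.symm) (hb _)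
    · by_cases hab : e1 = f1
      · subst hab
        have : e2 = f2 := Fin.ext (eq_of_adj_of_adj hG he.2 hf.2)
        subst this; rfl
      · have h1 := hadj (fun h => hab (Fin.ext h)) h
        have h2 : e2 = f1 := Fin.ext (eq_of_adj_of_adj hG he.2 h1)
        have h3 : e1 = f2 := Fin.ext (eq_of_adj_of_adj hG h1.symm hf.2)
        subst h2 h3
        exact absurd (he.1.trans hf.1) (lt_irrefl _)
  let s : SoloUser G n ⊕ UserPair G n → Set (ℕ → Bool) :=
    Sum.elim (fun a => {w | w a.1 = x a.1}) fun e => {w | w e.1.1 = x e.1.1 ∧ w e.1.2 = x e.1.2}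
  -- Each event has to be exhibited as a preimage under the samples of its own component.
  have hind := (hQ.groups_indep.precomp hκ).meas_iInter (s := s) (by
    rintro (a | e)
    · refine ⟨{f | f ⟨a.1, rfl⟩ = x a.1}, ?_, rfl⟩
      exact measurableSet_eq_fun (measurable_pi_apply _) measurable_const
    · have h2 : (e.1.2 : ℕ) ∈ (κ (.inr e)).supp :=
        (SimpleGraph.ConnectedComponent.sound e.2.2.reachable).symm
      refine ⟨{f | f ⟨e.1.1, rfl⟩ = x e.1.1} ∩ {f | f ⟨e.1.2, h2⟩ = x e.1.2}, ?_, rfl⟩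
      exact (measurableSet_eq_fun (measurable_pi_apply _) measurable_const).inter
        (measurableSet_eq_fun (measurable_pi_apply _) measurable_const))
  have hset : {w : ℕ → Bool | ∀ u : Fin n, w u = x u} = ⋂ i, s i := by
    ext w
    simp only [Set.mem_ofPred_eq, Set.mem_iInter]
    constructor
    · rintro h (a | e)
      · exact h _
      · exact ⟨h _, h _⟩
    · intro h u
      obtain ⟨g, rfl⟩ := (groupEquiv hG n).surjective u
      rcases g with a | e | e
      · exact h (.inl a)
      · exact (h (.inr e)).1
      · exact (h (.inr e)).2
  rw [rowLaw, hset, measureReal_def, hind, ENNReal.toReal_prod, Fintype.prod_sum_type]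
  congr 1
  · exact Finset.prod_congr rfl fun a _ => hQ.real_apply_eq a.1 (x a.1)
  · exact Finset.prod_congr rfl fun e _ => (pairLaw_eq _ _ (x e.1.1, x e.1.2)).symm

end IsTwoStateLaw

end Law

/-! ### The law of one row of samples and reports, given the drawn labels -/

section Row

variable {G : SimpleGraph ℕ} (hG : ∀ C : G.ConnectedComponent, C.supp.encard ≤ 2)
  (N : ℕ) (p : ℕ → ℝ) (Q : Measure (ℕ → Bool)) {n : ℕ}

/-- The label that user `v` has unless it draws one. -/
def defaultLabel (n : ℕ) (v : Fin n) : Fin (N + 1) :=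
  Sum.elim (fun a : SoloUser G n => gridFloor N (p a.1))
    (Sum.elim (fun e : UserPair G n => (pairLabel N (pairLaw Q e.1.1 e.1.2)).1)
      fun e => (pairLabel N (pairLaw Q e.1.1 e.1.2)).2) ((groupEquiv hG n).symm v)

/-- The probability that user `v` reports `true` when `c` are the drawn labels and `x` the true
samples. -/
def reportParam (c : Fin n → Option (Fin (N + 1))) (x : Fin n → Bool) (v : Fin n) : ℝ :=
  Sum.elim (fun a : SoloUser G n => soloParam N (p a.1) (c a.1) (x a.1))
    (Sum.elim
      (fun e : UserPair G n =>
        (pairParam N (pairLaw Q e.1.1 e.1.2) (c e.1.1, c e.1.2) (x e.1.1, x e.1.2)).1)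
      fun e => (pairParam N (pairLaw Q e.1.1 e.1.2) (c e.1.1, c e.1.2) (x e.1.1, x e.1.2)).2)
    ((groupEquiv hG n).symm v)

theorem reportParam_solo (c : Fin n → Option (Fin (N + 1))) (x : Fin n → Bool)
    (a : SoloUser G n) :
    reportParam hG N p Q c x a.1 = soloParam N (p a.1) (c a.1) (x a.1) := by
  rw [reportParam, groupEquiv_symm_solo]; rfl

theorem reportParam_fst (c : Fin n → Option (Fin (N + 1))) (x : Fin n → Bool)
    (e : UserPair G n) : reportParam hG N p Q c x e.1.1 =
      (pairParam N (pairLaw Q e.1.1 e.1.2) (c e.1.1, c e.1.2) (x e.1.1, x e.1.2)).1 := by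
  rw [reportParam, groupEquiv_symm_fst]; rfl

theorem reportParam_snd (c : Fin n → Option (Fin (N + 1))) (x : Fin n → Bool)
    (e : UserPair G n) : reportParam hG N p Q c x e.1.2 =
      (pairParam N (pairLaw Q e.1.1 e.1.2) (c e.1.1, c e.1.2) (x e.1.1, x e.1.2)).2 := by
  rw [reportParam, groupEquiv_symm_snd]; rfl

theorem defaultLabel_solo (a : SoloUser G n) :
    defaultLabel hG N p Q n a.1 = gridFloor N (p a.1) := by
  rw [defaultLabel, groupEquiv_symm_solo]; rfl

theorem defaultLabel_fst (e : UserPair G n) :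
    defaultLabel hG N p Q n e.1.1 = (pairLabel N (pairLaw Q e.1.1 e.1.2)).1 := by
  rw [defaultLabel, groupEquiv_symm_fst]; rfl

theorem defaultLabel_snd (e : UserPair G n) :
    defaultLabel hG N p Q n e.1.2 = (pairLabel N (pairLaw Q e.1.1 e.1.2)).2 := by
  rw [defaultLabel, groupEquiv_symm_snd]; rfl

/-- The probability of the true samples `x` and the reports `z` at a given time, given the drawn
labels `c`. -/
def rowJoint (c : Fin n → Option (Fin (N + 1))) (x z : Fin n → Bool) : ℝ :=
  rowLaw Q n x * rowProb id (reportParam hG N p Q c x) z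

/-- The probability of the reports `z` at a given time, given the drawn labels `c`. -/
def reportLaw (c : Fin n → Option (Fin (N + 1))) (z : Fin n → Bool) : ℝ :=
  rowProb (gridPoint N) (labelOf (defaultLabel hG N p Q n) c) z

theorem sum_rowJoint_right (c : Fin n → Option (Fin (N + 1))) (x : Fin n → Bool) :
    ∑ z, rowJoint hG N p Q c x z = rowLaw Q n x := by
  simp only [rowJoint, ← Finset.mul_sum, sum_rowProb, mul_one]

variable {p Q} (hQ : IsTwoStateLaw p G Q)
include hQ

theorem reportParam_mem_Icc (c : Fin n → Option (Fin (N + 1))) (x : Fin n → Bool) (v : Fin n) :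
    reportParam hG N p Q c x v ∈ Set.Icc (0 : ℝ) 1 := by
  have := hQ.isProb
  obtain ⟨g, rfl⟩ := (groupEquiv hG n).surjective v
  rcases g with a | e | e
  · rw [groupEquiv_solo, reportParam_solo]
    exact soloParam_mem_Icc N (hQ.param_mem_Icc _) _ _
  · rw [groupEquiv_fst, reportParam_fst]
    exact (pairParam_mem_Icc N (pairLaw_nonneg _ _) (sum_pairLaw _ _) _ _).1
  · rw [groupEquiv_snd, reportParam_snd]
    exact (pairParam_mem_Icc N (pairLaw_nonneg _ _) (sum_pairLaw _ _) _ _).2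

theorem rowJoint_nonneg (c : Fin n → Option (Fin (N + 1))) (x z : Fin n → Bool) :
    0 ≤ rowJoint hG N p Q c x z :=
  mul_nonneg (rowLaw_nonneg _ _)
    (Finset.prod_nonneg fun v _ => bern_nonneg (reportParam_mem_Icc hG N hQ c x v) _)

theorem rowJoint_eq_prod (c : Fin n → Option (Fin (N + 1))) (x z : Fin n → Bool) :
    rowJoint hG N p Q c x z =
      (∏ a : SoloUser G n, bern (p a.1) (x a.1) *
        bern (soloParam N (p a.1) (c a.1) (x a.1)) (z a.1)) *
      ∏ e : UserPair G n, pairLaw Q e.1.1 e.1.2 (x e.1.1, x e.1.2) *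
        (bern (pairParam N (pairLaw Q e.1.1 e.1.2) (c e.1.1, c e.1.2) (x e.1.1, x e.1.2)).1
            (z e.1.1) *
          bern (pairParam N (pairLaw Q e.1.1 e.1.2) (c e.1.1, c e.1.2) (x e.1.1, x e.1.2)).2
            (z e.1.2)) := by
  rw [rowJoint, rowProb, prod_eq_prod_groups hG, hQ.rowLaw_eq_prod hG]
  simp only [reportParam_solo, reportParam_fst, reportParam_snd, id, Finset.prod_mul_distrib]
  ring

theorem reportLaw_eq_prod (c : Fin n → Option (Fin (N + 1))) (z : Fin n → Bool) :
    reportLaw hG N p Q c z =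
      (∏ a : SoloUser G n, ∑ b, bern (p a.1) b * bern (soloParam N (p a.1) (c a.1) b) (z a.1)) *
      ∏ e : UserPair G n, ∑ b, pairLaw Q e.1.1 e.1.2 b *
        (bern (pairParam N (pairLaw Q e.1.1 e.1.2) (c e.1.1, c e.1.2) b).1 (z e.1.1) *
          bern (pairParam N (pairLaw Q e.1.1 e.1.2) (c e.1.1, c e.1.2) b).2 (z e.1.2)) := by
  have := hQ.isProb
  rw [reportLaw, rowProb, prod_eq_prod_groups hG]
  congr 1
  · refine Finset.prod_congr rfl fun a _ => ?_
    rw [sum_bern_soloParam N (hQ.param_mem_Icc _), labelOf, defaultLabel_solo]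
  · refine Finset.prod_congr rfl fun e _ => ?_
    rw [sum_mul_bern_pairParam N (pairLaw_nonneg _ _) (sum_pairLaw _ _) (c e.1.1, c e.1.2)
      (z e.1.1, z e.1.2), labelOf, labelOf, defaultLabel_fst, defaultLabel_snd]

/-- The sum over the true samples factorizes over the groups, and within each group the channel
produces independent reports. So, given the drawn labels, reports depend on parameters and pair laws
through labels only. -/
theorem sum_rowJoint_left (c : Fin n → Option (Fin (N + 1))) (z : Fin n → Bool) :
    ∑ x, rowJoint hG N p Q c x z = reportLaw hG N p Q c z := by
  simp only [rowJoint_eq_prod hG N hQ, reportLaw_eq_prod hG N hQ, Fintype.prod_sum]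
  exact sum_mul_groups hG n
    (fun y => ∏ a : SoloUser G n, bern (p a.1) (y a) *
        bern (soloParam N (p a.1) (c a.1) (y a)) (z a.1))
    (fun y => ∏ e : UserPair G n, pairLaw Q e.1.1 e.1.2 (y e) *
        (bern (pairParam N (pairLaw Q e.1.1 e.1.2) (c e.1.1, c e.1.2) (y e)).1 (z e.1.1) *
          bern (pairParam N (pairLaw Q e.1.1 e.1.2) (c e.1.1, c e.1.2) (y e)).2 (z e.1.2)))

/-- The law of the sample of an isolated user given all reports. -/
theorem sum_rowJoint_mul_solo (c : Fin n → Option (Fin (N + 1))) (z : Fin n → Bool)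
    (a : SoloUser G n) (ξ : Bool → ℝ) :
    bern (gridPoint N (labelOf (defaultLabel hG N p Q n) c a.1)) (z a.1) *
        ∑ x, rowJoint hG N p Q c x z * ξ (x a.1) =
      reportLaw hG N p Q c z * ∑ b, bern (p a.1) b *
        bern (soloParam N (p a.1) (c a.1) b) (z a.1) * ξ b := by
  set w : SoloUser G n → Bool → ℝ := fun a b =>
    bern (p a.1) b * bern (soloParam N (p a.1) (c a.1) b) (z a.1) with hw
  have h := sum_mul_groups hG n (fun y => (∏ a, w a (y a)) * ξ (y a))
    (fun y => ∏ e : UserPair G n, pairLaw Q e.1.1 e.1.2 (y e) *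
        (bern (pairParam N (pairLaw Q e.1.1 e.1.2) (c e.1.1, c e.1.2) (y e)).1 (z e.1.1) *
          bern (pairParam N (pairLaw Q e.1.1 e.1.2) (c e.1.1, c e.1.2) (y e)).2 (z e.1.2)))
  rw [sum_prod_mul_apply] at h
  have h2 : ∑ x, rowJoint hG N p Q c x z * ξ (x a.1) = _ :=
    (Finset.sum_congr rfl fun x _ => by rw [rowJoint_eq_prod hG N hQ, mul_right_comm]).trans h
  -- The user's own factor completes the product to the full report law, which expresses
  -- conditioning without a division.
  have h3 : bern (gridPoint N (labelOf (defaultLabel hG N p Q n) c a.1)) (z a.1) = ∑ b, w a b := by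
    rw [hw, sum_bern_soloParam N (hQ.param_mem_Icc _), labelOf, defaultLabel_solo]
  rw [h2, h3, reportLaw_eq_prod hG N hQ, ← Finset.mul_prod_erase _ _ (Finset.mem_univ a),
    Fintype.prod_sum (ι := UserPair G n)]
  simp only [hw]
  ring

/-- The law of the samples of an associated pair given all reports. -/
theorem sum_rowJoint_mul_pair (c : Fin n → Option (Fin (N + 1))) (z : Fin n → Bool)
    (e : UserPair G n) (ξ : Bool × Bool → ℝ) :
    bern (gridPoint N (labelOf (defaultLabel hG N p Q n) c e.1.1)) (z e.1.1) *
      bern (gridPoint N (labelOf (defaultLabel hG N p Q n) c e.1.2)) (z e.1.2) *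
        ∑ x, rowJoint hG N p Q c x z * ξ (x e.1.1, x e.1.2) =
      reportLaw hG N p Q c z * ∑ b, pairLaw Q e.1.1 e.1.2 b *
        (bern (pairParam N (pairLaw Q e.1.1 e.1.2) (c e.1.1, c e.1.2) b).1 (z e.1.1) *
          bern (pairParam N (pairLaw Q e.1.1 e.1.2) (c e.1.1, c e.1.2) b).2 (z e.1.2)) * ξ b := by
  have := hQ.isProb
  set w : UserPair G n → Bool × Bool → ℝ := fun e b => pairLaw Q e.1.1 e.1.2 b *
        (bern (pairParam N (pairLaw Q e.1.1 e.1.2) (c e.1.1, c e.1.2) b).1 (z e.1.1) *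
          bern (pairParam N (pairLaw Q e.1.1 e.1.2) (c e.1.1, c e.1.2) b).2 (z e.1.2)) with hw
  have h := sum_mul_groups hG n (fun y => ∏ a : SoloUser G n, bern (p a.1) (y a) *
        bern (soloParam N (p a.1) (c a.1) (y a)) (z a.1))
    (fun y => (∏ e, w e (y e)) * ξ (y e))
  rw [sum_prod_mul_apply] at h
  have h2 : ∑ x, rowJoint hG N p Q c x z * ξ (x e.1.1, x e.1.2) = _ :=
    (Finset.sum_congr rfl fun x _ => by rw [rowJoint_eq_prod hG N hQ, mul_assoc]).trans h
  have h3 : bern (gridPoint N (labelOf (defaultLabel hG N p Q n) c e.1.1)) (z e.1.1) *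
      bern (gridPoint N (labelOf (defaultLabel hG N p Q n) c e.1.2)) (z e.1.2) = ∑ b, w e b := by
    rw [hw, sum_mul_bern_pairParam N (pairLaw_nonneg _ _) (sum_pairLaw _ _) (c e.1.1, c e.1.2)
      (z e.1.1, z e.1.2), labelOf, labelOf, defaultLabel_fst, defaultLabel_snd]
  rw [h2, h3, reportLaw_eq_prod hG N hQ, ← Finset.mul_prod_erase _ _ (Finset.mem_univ e),
    Fintype.prod_sum (ι := SoloUser G n)]
  simp only [hw]
  ring

/-- For actual sample laws all parameters lie in `[0,1]`, so the clamping in the scheme has no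
effect. -/
theorem rowLaw_mul_channel (r : Fin n → Seed) (x z : Fin n → Bool) :
    rowLaw Q n x * roundingScheme.channel G Q n r x z =
      rowJoint hG (gridSize n) p Q (fun v => seedLabel (gridSize n) (r v)) x z := by
  classical
  have := hQ.isProb
  rw [rowJoint, rowProb, prod_eq_prod_groups hG, ObfuscationScheme.channel]
  congr 2
  · rw [Finset.prod_subtype _ (p := fun u : Fin n => ∀ v : Fin n, ¬ G.Adj u v)
      (fun u => by simp only [Finset.mem_filter_univ])]
    refine Finset.prod_congr rfl fun a _ => ?_
    have hp : (Q.map fun w => w (a.1 : ℕ)).real {true} = p a.1 := by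
      rw [map_measureReal_apply (measurable_pi_apply _) (measurableSet_singleton _)]
      exact hQ.bernoulli _
    simp only [roundingScheme, hp, reportParam_solo, id]
    exact toReal_bernPMF (soloParam_mem_Icc _ (hQ.param_mem_Icc _) _ _) _
  · rw [Finset.prod_subtype _ (p := fun e : Fin n × Fin n => e.1 < e.2 ∧ G.Adj e.1 e.2)
      (fun u => by simp only [Finset.mem_filter_univ])]
    refine Finset.prod_congr rfl fun e _ => ?_
    have h := pairParam_mem_Icc (gridSize n) (pairLaw_nonneg (Q := Q) e.1.1 e.1.2)
      (sum_pairLaw _ _) (seedLabel (gridSize n) (r e.1.1), seedLabel (gridSize n) (r e.1.2))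
      (x e.1.1, x e.1.2)
    simp only [roundingScheme, reportParam_fst, reportParam_snd, id]
    exact toReal_bernPairPMF h.1 h.2 _

/-- Noise parameters are kept for the whole data sequence, so the mean over labels stands outside
the product over times. -/
theorem jointXZ_roundingScheme (m : ℕ) (x z : Fin m → Fin n → Bool) :
    roundingScheme.jointXZ G Q n m x z = prodMean (fun _ => labelWeight (gridSize n))
      (fun c => ∏ k, rowJoint hG (gridSize n) p Q c (x k) (z k)) := by
  rw [← integral_seedLabel, ObfuscationScheme.jointXZ, ← integral_const_mul]
  simp only [← rowLaw_mul_channel hG hQ, Finset.prod_mul_distrib]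
  rfl

end Row

/-! ### Privacy -/

/-- Used with `h / β` as a conditional mean given reports of probability `β`: where `β` vanishes, so
does `h`. -/
theorem sum_mul_div_self {α : Type*} [Fintype α] {h β : α → ℝ} (hβ : ∀ a, |h a| ≤ β a) :
    ∑ a, β a * (h a / β a) = ∑ a, h a := by
  refine Finset.sum_congr rfl fun a _ => ?_
  rcases eq_or_ne (β a) 0 with h0 | h0
  · have := hβ a
    rw [h0] at this
    rw [h0, zero_mul, abs_nonpos_iff.1 this]
  · rw [mul_div_cancel₀ _ h0]

theorem abs_div_le_one_of_abs_le {h β : ℝ} (hβ : |h| ≤ β) : |h / β| ≤ 1 := by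
  rw [abs_div, abs_of_nonneg ((abs_nonneg h).trans hβ)]
  exact div_le_one_of_le₀ hβ ((abs_nonneg h).trans hβ)

theorem abs_sum_mul_le_sum {α : Type*} [Fintype α] {w ξ : α → ℝ} (hw : ∀ a, 0 ≤ w a)
    (hξ : ∀ a, |ξ a| ≤ 1) : |∑ a, w a * ξ a| ≤ ∑ a, w a := by
  refine (Finset.abs_sum_le_sum_abs _ _).trans (Finset.sum_le_sum fun a _ => ?_)
  rw [abs_mul, abs_of_nonneg (hw a)]
  exact mul_le_of_le_one_right (hw a) (hξ a)

theorem ObfuscationScheme.jointXY_nonneg (S : ObfuscationScheme) (G : SimpleGraph ℕ)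
    (Q : Measure (ℕ → Bool)) {n m : ℕ} (x y : Fin m → Fin n → Bool) :
    0 ≤ S.jointXY G Q n m x y := by
  refine mul_nonneg (by positivity) (Finset.sum_nonneg fun π _ => ?_)
  refine mul_nonneg (Finset.prod_nonneg fun k _ => measureReal_nonneg) ?_
  refine integral_nonneg fun r => Finset.prod_nonneg fun k _ => ?_
  exact mul_nonneg (Finset.prod_nonneg fun _ _ => ENNReal.toReal_nonneg)
    (Finset.prod_nonneg fun _ _ => ENNReal.toReal_nonneg)

section Privacy

variable {G : SimpleGraph ℕ} (hG : ∀ C : G.ConnectedComponent, C.supp.encard ≤ 2)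
  {p : ℕ → ℝ} {Q : Measure (ℕ → Bool)} (hQ : IsTwoStateLaw p G Q)
include hG hQ

theorem sum_jointXZ_right {n m : ℕ} (x : Fin m → Fin n → Bool) :
    ∑ z, roundingScheme.jointXZ G Q n m x z = ∏ k, rowLaw Q n (x k) := by
  simp only [jointXZ_roundingScheme hG hQ]
  have h3 : ∀ c : Fin n → Option (Fin (gridSize n + 1)), ∑ z : Fin m → Fin n → Bool,
      ∏ k, rowJoint hG (gridSize n) p Q c (x k) (z k) = ∏ k, rowLaw Q n (x k) := by
    intro c
    rw [← Fintype.prod_sum fun k z => rowJoint hG (gridSize n) p Q c (x k) z]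
    simp only [sum_rowJoint_right]
  rw [← prodMean_sum, prodMean_congr _ h3, prodMean_const fun _ => sum_labelWeight _]

theorem sum_jointXY_right {n m : ℕ} (x : Fin m → Fin n → Bool) :
    ∑ y, roundingScheme.jointXY G Q n m x y = ∏ k, rowLaw Q n (x k) := by
  have h1 : ∀ π : Equiv.Perm (Fin n), ∑ y : Fin m → Fin n → Bool,
      roundingScheme.jointXZ G Q n m x (fun k u => y k (π u)) =
      ∑ z, roundingScheme.jointXZ G Q n m x z := fun π =>
    Fintype.sum_equiv (Equiv.piCongrRight fun _ => Equiv.arrowCongr π.symm (Equiv.refl _))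
      _ _ fun y => rfl
  simp only [ObfuscationScheme.jointXY]
  rw [← Finset.mul_sum, Finset.sum_comm]
  simp only [h1, sum_jointXZ_right hG hQ]
  rw [Finset.sum_const, Finset.card_univ, Fintype.card_perm, Fintype.card_fin, nsmul_eq_mul,
    inv_mul_cancel_left₀ (by positivity)]

theorem sum_sum_jointXY_mul {n m : ℕ} (u : Fin n) (k : Fin m) (ξ : Bool → ℝ) :
    ∑ y, ∑ x, roundingScheme.jointXY G Q n m x y * ξ (x k u) = ∑ b, bern (p u) b * ξ b := by
  have := hQ.isProb
  rw [Finset.sum_comm]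
  simp only [← Finset.sum_mul, sum_jointXY_right hG hQ]
  have hsum : ∑ x : Fin n → Bool, rowLaw Q n x = 1 := by
    simpa using sum_rowLaw_mul (Q := Q) n fun _ => 1
  rw [sum_prod_mul_apply (fun _ : Fin m => rowLaw Q n) k (fun x => ξ (x u)), hsum,
    Finset.prod_const_one, mul_one, sum_rowLaw_mul n fun x => ξ (x u), hQ.integral_apply]

/-- The law of a sample of user `u` and of the anonymized reports. -/
theorem sum_jointXY_mul {n m : ℕ} (u : Fin n) (k : Fin m) (ξ : Bool → ℝ)
    (y : Fin m → Fin n → Bool) :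
    ∑ x, roundingScheme.jointXY G Q n m x y * ξ (x k u) =
      (n.factorial : ℝ)⁻¹ * ∑ π : Equiv.Perm (Fin n),
        ∑ c : Fin n → Option (Fin (gridSize n + 1)), (∏ i, labelWeight (gridSize n) (c i)) *
          ((∑ x, rowJoint hG (gridSize n) p Q c x (y k ∘ π) * ξ (x u)) *
            ∏ i ∈ Finset.univ.erase k, reportLaw hG (gridSize n) p Q c (y i ∘ π)) := by
  simp only [ObfuscationScheme.jointXY, mul_assoc, jointXZ_roundingScheme hG hQ]
  rw [← Finset.mul_sum]
  congr 1
  simp only [Finset.sum_mul]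
  rw [Finset.sum_comm]
  refine Finset.sum_congr rfl fun π _ => ?_
  simp only [prodMean, Finset.sum_mul]
  rw [Finset.sum_comm]
  refine Finset.sum_congr rfl fun c _ => ?_
  simp only [mul_assoc]
  rw [← Finset.mul_sum]
  congr 1
  have := sum_prod_mul_apply (fun (i : Fin m) (x : Fin n → Bool) =>
    rowJoint hG (gridSize n) p Q c x (y i ∘ π)) k (fun x => ξ (x u))
  simp only [sum_rowJoint_left hG _ hQ] at this
  refine this.trans ?_
  rw [Finset.sum_mul]
  simp only [mul_assoc]

/-- Here `h / β` is the conditional mean of `ξ` given the reports; at reports of probability zero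
both sides vanish. -/
theorem eq_div_mul_reportLaw {n : ℕ} {N : ℕ} (c : Fin n → Option (Fin (N + 1)))
    (z : Fin n → Bool) {ξ : (Fin n → Bool) → ℝ} (hξ : ∀ x, |ξ x| ≤ 1) {h β : ℝ}
    (hβ0 : β = 0 → reportLaw hG N p Q c z = 0)
    (hβ : β * ∑ x, rowJoint hG N p Q c x z * ξ x = reportLaw hG N p Q c z * h) :
    ∑ x, rowJoint hG N p Q c x z * ξ x = h / β * reportLaw hG N p Q c z := by
  rcases eq_or_ne β 0 with h0 | h0
  · have hle := abs_sum_mul_le_sum (fun x => rowJoint_nonneg hG N hQ c x z) hξ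
    rw [sum_rowJoint_left hG N hQ, hβ0 h0] at hle
    rw [abs_nonpos_iff.1 hle, hβ0 h0, mul_zero]
  · field_simp
    linarith

/-- Writing row `k` as conditional mean times report law completes the product over all times, which
is the form that the hiding bounds require. -/
theorem sum_abs_sum_jointXY_mul_eq {n m : ℕ} (u : Fin n) (k : Fin m) (ξ : Bool → ℝ)
    (ψ : (Fin n → Option (Fin (gridSize n + 1))) → (Fin n → Bool) → ℝ)
    (hψ : ∀ c z, ∑ x, rowJoint hG (gridSize n) p Q c x z * ξ (x u) =
      ψ c z * reportLaw hG (gridSize n) p Q c z) :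
    ∑ y, |∑ x, roundingScheme.jointXY G Q n m x y * ξ (x k u)| =
      ∑ y : Fin m → Fin n → Bool, |(n.factorial : ℝ)⁻¹ *
        ∑ π : Equiv.Perm (Fin n), ∑ c : Fin n → Option (Fin (gridSize n + 1)),
          (∏ i, labelWeight (gridSize n) (c i)) * (ψ c (y k ∘ π) * ∏ i,
            rowProb (gridPoint (gridSize n)) (labelOf (defaultLabel hG (gridSize n) p Q n) c)
              (y i ∘ π))| := by
  refine Finset.sum_congr rfl fun y _ => ?_
  rw [sum_jointXY_mul hG hQ]
  congr 2
  refine Finset.sum_congr rfl fun π _ => Finset.sum_congr rfl fun c _ => ?_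
  rw [hψ, mul_assoc, ← Finset.mul_prod_erase _ _ (Finset.mem_univ k)]
  rfl

theorem sum_abs_sum_jointXY_mul_pair_le {n m : ℕ} (hn : 2 < n) (u : Fin n) (k : Fin m)
    (ξ : Bool → ℝ) (e : UserPair G n) (ζ : Bool × Bool → ℝ) (hζ : ∀ b, |ζ b| ≤ 1)
    (hζ0 : ∑ b, pairLaw Q e.1.1 e.1.2 b * ζ b = 0)
    (hζξ : ∀ x : Fin n → Bool, ζ (x e.1.1, x e.1.2) = ξ (x u)) :
    ∑ y, |∑ x, roundingScheme.jointXY G Q n m x y * ξ (x k u)| ≤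
      6 / √((n - 2 : ℝ) * (1 / ((gridSize n : ℝ) + 1) ^ 2)) := by
  have := hQ.isProb
  set N := gridSize n with hN
  let β : (Fin n → Option (Fin (N + 1))) → Fin n → Bool → ℝ := fun c v b =>
    bern (gridPoint N (labelOf (defaultLabel hG N p Q n) c v)) b
  let K : (Fin n → Option (Fin (N + 1))) → Bool × Bool → Bool × Bool → ℝ := fun c z b =>
    pairLaw Q e.1.1 e.1.2 b *
      (bern (pairParam N (pairLaw Q e.1.1 e.1.2) (c e.1.1, c e.1.2) b).1 z.1 *
        bern (pairParam N (pairLaw Q e.1.1 e.1.2) (c e.1.1, c e.1.2) b).2 z.2)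
  have hK0 : ∀ c z b, 0 ≤ K c z b := by
    intro c z b
    have h := pairParam_mem_Icc N (pairLaw_nonneg (Q := Q) e.1.1 e.1.2) (sum_pairLaw _ _)
      (c e.1.1, c e.1.2) b
    exact mul_nonneg (pairLaw_nonneg _ _ _) (mul_nonneg (bern_nonneg h.1 _) (bern_nonneg h.2 _))
  have hKβ : ∀ c z, ∑ b, K c z b = β c e.1.1 z.1 * β c e.1.2 z.2 := by
    intro c z
    refine (sum_mul_bern_pairParam N (pairLaw_nonneg _ _) (sum_pairLaw _ _) _ z).trans ?_
    simp only [β, labelOf, defaultLabel_fst, defaultLabel_snd]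
  let h : (Fin n → Option (Fin (N + 1))) → Bool × Bool → ℝ := fun c z => ∑ b, K c z b * ζ b
  have hh : ∀ c z, |h c z| ≤ β c e.1.1 z.1 * β c e.1.2 z.2 := fun c z =>
    (abs_sum_mul_le_sum (hK0 c z) hζ).trans_eq (hKβ c z)
  -- Summing over the reports removes the channel and leaves the mean of `ζ`.
  have hh0 : ∀ c, ∑ z, h c z = 0 := by
    intro c
    rw [Finset.sum_comm, ← hζ0]
    refine Finset.sum_congr rfl fun b _ => ?_
    rw [← Finset.sum_mul]
    simp only [K]
    rw [← Finset.mul_sum, Fintype.sum_prod_type]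
    simp only [← Finset.mul_sum, sum_bern, mul_one]
  have hne : e.1.1 ≠ e.1.2 := e.2.1.ne
  rw [sum_abs_sum_jointXY_mul_eq hG hQ u k ξ
    fun c z => h c (z e.1.1, z e.1.2) / (β c e.1.1 (z e.1.1) * β c e.1.2 (z e.1.2))]
  · have key := sum_abs_perm_mean_pair_le (M := Fin m) (θ := gridPoint N) (gridPoint_mem_Icc N)
      (defaultLabel hG N p Q n)
      (labelWeight N) (labelWeight_nonneg N) (sum_labelWeight N) (q := 1 / ((N : ℝ) + 1) ^ 2)
      (by positivity) (labelWeight_some N) e.1.1 e.1.2 hne (by rwa [Fintype.card_fin]) k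
      (fun c z => h c (z e.1.1, z e.1.2) / (β c e.1.1 (z e.1.1) * β c e.1.2 (z e.1.2)))
    simp only [Fintype.card_fin] at key
    refine key ?_ ?_ ?_
    · exact fun c z => abs_div_le_one_of_abs_le (hh c _)
    · intro c z j h1 h2 b
      simp only [Function.update_of_ne h1.symm, Function.update_of_ne h2.symm]
    · intro c z
      have key := sum_mul_div_self (β := fun z : Bool × Bool => β c e.1.1 z.1 * β c e.1.2 z.2)
        (h := h c) (hh c)
      rw [hh0, Fintype.sum_prod_type, Finset.sum_comm] at key
      rw [← key]
      refine Finset.sum_congr rfl fun b _ => ?_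
      rw [Finset.mul_sum]
      refine Finset.sum_congr rfl fun a _ => ?_
      simp only [Function.update_self, Function.update_of_ne hne.symm]
      rw [← mul_assoc, mul_comm (bern _ b)]
  · intro c z
    simp only [← hζξ]
    refine eq_div_mul_reportLaw hG hQ c z (fun x => hζ _) ?_
      (sum_rowJoint_mul_pair hG N hQ c z e ζ)
    intro h0
    rcases mul_eq_zero.1 h0 with h0 | h0
    · exact Finset.prod_eq_zero (Finset.mem_univ e.1.1) h0
    · exact Finset.prod_eq_zero (Finset.mem_univ e.1.2) h0

theorem sum_abs_sum_jointXY_mul_solo_le {n m : ℕ} (hn : 1 < n) (a : SoloUser G n) (k : Fin m)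
    (ξ : Bool → ℝ) (hξ : ∀ b, |ξ b| ≤ 1) (hξ0 : ∑ b, bern (p a.1) b * ξ b = 0) :
    ∑ y, |∑ x, roundingScheme.jointXY G Q n m x y * ξ (x k a.1)| ≤
      2 / √((n - 1 : ℝ) * (1 / ((gridSize n : ℝ) + 1) ^ 2)) := by
  have := hQ.isProb
  set N := gridSize n with hN
  let β : (Fin n → Option (Fin (N + 1))) → Fin n → Bool → ℝ := fun c v b =>
    bern (gridPoint N (labelOf (defaultLabel hG N p Q n) c v)) b
  let K : (Fin n → Option (Fin (N + 1))) → Bool → Bool → ℝ := fun c z b =>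
    bern (p a.1) b * bern (soloParam N (p a.1) (c a.1) b) z
  have hK0 : ∀ c z b, 0 ≤ K c z b := fun c z b =>
    mul_nonneg (bern_nonneg (hQ.param_mem_Icc _) _)
      (bern_nonneg (soloParam_mem_Icc N (hQ.param_mem_Icc _) _ _) _)
  have hKβ : ∀ c z, ∑ b, K c z b = β c a.1 z := by
    intro c z
    refine (sum_bern_soloParam N (hQ.param_mem_Icc _) _ z).trans ?_
    simp only [β, labelOf, defaultLabel_solo]
  let h : (Fin n → Option (Fin (N + 1))) → Bool → ℝ := fun c z => ∑ b, K c z b * ξ b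
  have hh : ∀ c z, |h c z| ≤ β c a.1 z := fun c z =>
    (abs_sum_mul_le_sum (hK0 c z) hξ).trans_eq (hKβ c z)
  have hh0 : ∀ c, ∑ z, h c z = 0 := by
    intro c
    rw [Finset.sum_comm, ← hξ0]
    refine Finset.sum_congr rfl fun b _ => ?_
    rw [← Finset.sum_mul]
    simp only [K]
    rw [← Finset.mul_sum, sum_bern, mul_one]
  rw [sum_abs_sum_jointXY_mul_eq hG hQ a.1 k ξ fun c z => h c (z a.1) / β c a.1 (z a.1)]
  · have key := sum_abs_perm_mean_le (M := Fin m) (θ := gridPoint N) (gridPoint_mem_Icc N)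
      (defaultLabel hG N p Q n)
      (labelWeight N) (labelWeight_nonneg N) (sum_labelWeight N) (q := 1 / ((N : ℝ) + 1) ^ 2)
      (by positivity) (labelWeight_some N) a.1 {a.1} (by simp)
      (by rw [Fintype.card_fin, Finset.card_singleton]; exact hn) k
      (fun c z => h c (z a.1) / β c a.1 (z a.1)) (C := 1) zero_le_one
    simp only [Fintype.card_fin, Finset.card_singleton, mul_one, Nat.cast_one] at key
    refine key ?_ ?_ ?_
    · exact fun c z => abs_div_le_one_of_abs_le (hh c _)
    · intro c z j hj b
      have hj' : a.1 ≠ j := fun h => hj (by simp [h])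
      simp only [Function.update_of_ne hj']
    · intro c z
      simp only [Function.update_self]
      exact (sum_mul_div_self (hh c)).trans (hh0 c)
  · intro c z
    exact eq_div_mul_reportLaw hG hQ c z (fun x => hξ _)
      (fun h0 => Finset.prod_eq_zero (Finset.mem_univ a.1) h0)
      (sum_rowJoint_mul_solo hG N hQ c z a ξ)

theorem sum_abs_sum_jointXY_mul_le {n m : ℕ} (hn : 2 < n) (u : Fin n) (k : Fin m) (ξ : Bool → ℝ)
    (hξ : ∀ b, |ξ b| ≤ 1) (hξ0 : ∑ b, bern (p u) b * ξ b = 0) :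
    ∑ y, |∑ x, roundingScheme.jointXY G Q n m x y * ξ (x k u)| ≤
      6 / √((n - 2 : ℝ) * (1 / ((gridSize n : ℝ) + 1) ^ 2)) := by
  have := hQ.isProb
  have hn' : (2 : ℝ) < n := by exact_mod_cast hn
  obtain ⟨g, rfl⟩ := (groupEquiv hG n).surjective u
  rcases g with a | e | e
  · refine (sum_abs_sum_jointXY_mul_solo_le hG hQ (by omega) a k ξ hξ hξ0).trans ?_
    exact div_le_div₀ (by norm_num) (by norm_num)
      (Real.sqrt_pos.2 (mul_pos (by linarith) (by positivity)))
      (Real.sqrt_le_sqrt (mul_le_mul_of_nonneg_right (by linarith) (by positivity)))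
  · refine sum_abs_sum_jointXY_mul_pair_le hG hQ hn _ k ξ e (fun b => ξ b.1) (fun b => hξ _) ?_
      fun x => rfl
    rw [sum_pairLaw_mul _ _ fun b => ξ b.1, hQ.integral_apply _ ξ]
    exact hξ0
  · refine sum_abs_sum_jointXY_mul_pair_le hG hQ hn _ k ξ e (fun b => ξ b.2) (fun b => hξ _) ?_
      fun x => rfl
    rw [sum_pairLaw_mul _ _ fun b => ξ b.2, hQ.integral_apply _ ξ]
    exact hξ0

theorem leakage_mem_Icc {n : ℕ} (hn : 2 < n) (m u k : ℕ) (hp0 : 0 < p u) (hp1 : p u < 1) :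
    roundingScheme.leakage G Q n m u k ∈ Set.Icc 0
      (6 / √((n - 2 : ℝ) * (1 / ((gridSize n : ℝ) + 1) ^ 2)) / (p u * (1 - p u))) := by
  unfold ObfuscationScheme.leakage
  split_ifs with huk
  · set v : Fin n := ⟨u, huk.1⟩
    set i : Fin m := ⟨k, huk.2⟩
    set P : Bool → (Fin m → Fin n → Bool) → ℝ := fun a y =>
      ∑ x : Fin m → Fin n → Bool with x i v = a, roundingScheme.jointXY G Q n m x y with hP
    have hPeq : ∀ a y, P a y =
        ∑ x, roundingScheme.jointXY G Q n m x y * (fun b => if b = a then (1 : ℝ) else 0) (x i v) := by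
      intro a y
      simp only [hP, mul_ite, mul_one, mul_zero]
      rw [Finset.sum_filter]
    have hPsum : ∀ a, ∑ y, P a y = bern (p u) a := by
      intro a
      simp only [hPeq]
      rw [sum_sum_jointXY_mul hG hQ v i fun b => if b = a then (1 : ℝ) else 0]
      simp [v]
    have hmi := mutualInfo_mem_Icc P
      (fun a y => Finset.sum_nonneg fun x _ => ObfuscationScheme.jointXY_nonneg _ G Q x y) hp0 hp1
      ((hPsum true).trans (by simp [bern])) ((hPsum false).trans (by simp [bern]))
    refine ⟨hmi.1, hmi.2.trans ?_⟩
    have hpos : 0 < p u * (1 - p u) := mul_pos hp0 (by linarith)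
    gcongr
    -- The deviation from the product law is the integral of the centred test function "indicator of
    -- `true` minus `p u`".
    have hD : ∀ y, P true y - p u * (P true y + P false y) =
        ∑ x, roundingScheme.jointXY G Q n m x y *
          (fun b => (if b then (1 : ℝ) else 0) - p u) (x i v) := by
      intro y
      simp only [hPeq, ← Finset.sum_add_distrib, Finset.mul_sum, ← Finset.sum_sub_distrib]
      refine Finset.sum_congr rfl fun x _ => ?_
      cases x i v <;> simp <;> ring
    simp only [hD]
    refine sum_abs_sum_jointXY_mul_le hG hQ hn v i (fun b => (if b then (1 : ℝ) else 0) - p u)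
      (fun b => ?_) ?_
    · cases b <;> simp only [Bool.false_eq_true, if_false, if_true, abs_le] <;>
        constructor <;> linarith
    · simp [bern, v]; ring
  · refine ⟨le_rfl, ?_⟩
    have : 0 < p u * (1 - p u) := mul_pos hp0 (by linarith)
    positivity

end Privacy

/-- The mean number of users with a given label tends to infinity. -/
theorem tendsto_mean_labels :
    Tendsto (fun n : ℕ => (n - 2 : ℝ) * (1 / ((gridSize n : ℝ) + 1) ^ 2)) atTop atTop := by
  have hs : Tendsto Nat.sqrt atTop atTop :=
    tendsto_atTop_atTop.2 fun b => ⟨b * b, fun a ha => Nat.le_sqrt.2 ha⟩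
  -- With `K = n.sqrt.sqrt`: `K ^ 4 ≤ n`, `(K + 2) ^ 2 ≤ 9 * K ^ 2` for `K ≥ 1`, and `n ≤ 2 * (n -
  -- 2)` for `n ≥ 4`; hence `18 = 9 * 2`.
  have h : Tendsto (fun n : ℕ => ((n.sqrt.sqrt : ℕ) : ℝ) ^ 2 / 18) atTop atTop := by
    refine Tendsto.atTop_div_const (by norm_num) ?_
    exact (tendsto_pow_atTop two_ne_zero).comp
      (tendsto_natCast_atTop_atTop.comp (hs.comp hs))
  refine tendsto_atTop_mono' _ ?_ h
  filter_upwards [eventually_ge_atTop 4] with n hn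
  set K := n.sqrt.sqrt with hK
  have hK1 : 1 ≤ K := Nat.le_sqrt.2 (Nat.le_sqrt.2 (by omega))
  have hK4 : (K * K) * (K * K) ≤ n :=
    (Nat.mul_le_mul (Nat.sqrt_le n.sqrt) (Nat.sqrt_le n.sqrt)).trans (Nat.sqrt_le n)
  have k1 : (1 : ℝ) ≤ K := by exact_mod_cast hK1
  have k4 : ((K : ℝ) * K) * (K * K) ≤ n := by exact_mod_cast hK4
  have n4 : (4 : ℝ) ≤ n := by exact_mod_cast hn
  have e : (gridSize n : ℝ) + 1 = K + 2 := by simp only [gridSize, ← hK]; push_cast; ring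
  rw [e, mul_one_div, div_le_div_iff₀ (by norm_num) (by positivity)]
  have h1 : ((K : ℝ) + 2) ^ 2 ≤ 9 * K ^ 2 := by nlinarith
  calc (K : ℝ) ^ 2 * ((K : ℝ) + 2) ^ 2 ≤ (K : ℝ) ^ 2 * (9 * (K : ℝ) ^ 2) := by gcongr
    _ = 9 * (((K : ℝ) * K) * (K * K)) := by ring
    _ ≤ 9 * (n : ℝ) := by gcongr
    _ ≤ ((n : ℝ) - 2) * 18 := by linarith

/-- The leakage bound decays like the mean number of decoys to the power `-1/2` and does not involve
the number of samples. -/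
theorem perfectPrivacy_roundingScheme {G : SimpleGraph ℕ}
    (hG : ∀ C : G.ConnectedComponent, C.supp.encard ≤ 2) {p : ℕ → ℝ} {Q : Measure (ℕ → Bool)}
    (hQ : IsTwoStateLaw p G Q) (m : ℕ → ℕ) (u : ℕ) (hp0 : 0 < p u) (hp1 : p u < 1) :
    roundingScheme.PerfectPrivacy G Q m u := by
  intro k
  have h : Tendsto (fun n : ℕ => 6 / √((n - 2 : ℝ) * (1 / ((gridSize n : ℝ) + 1) ^ 2)) /
      (p u * (1 - p u))) atTop (𝓝 0) := by
    have := ((Real.tendsto_sqrt_atTop.comp tendsto_mean_labels).const_div_atTop 6).div_const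
      (p u * (1 - p u))
    rwa [zero_div] at this
  refine tendsto_of_tendsto_of_tendsto_of_le_of_le' tendsto_const_nhds h ?_ ?_
  · filter_upwards [eventually_gt_atTop 2] with n hn
    exact (leakage_mem_Icc hG hQ hn (m n) u k hp0 hp1).1
  · filter_upwards [eventually_gt_atTop 2] with n hn
    exact (leakage_mem_Icc hG hQ hn (m n) u k hp0 hp1).2

/-! ### The noise level -/

/-- Chebyshev's inequality for the frequency of an event in `m` independent trials. -/
theorem prodMean_frequency_le {α : Type*} [Fintype α] {w : α → ℝ} (h0 : ∀ a, 0 ≤ w a)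
    (h1 : ∑ a, w a = 1) (A : α → Prop) [DecidablePred A] {m : ℕ} (hm : 0 < m) {t : ℝ}
    (ht : ∑ a, w a * (if A a then 1 else 0) < t) :
    prodMean (fun _ : Fin m => w)
      (fun f => if t < (Finset.card {k : Fin m | A (f k)} : ℝ) / m then 1 else 0) ≤
      1 / (√m * (t - ∑ a, w a * (if A a then 1 else 0))) := by
  set I : α → ℝ := fun a => if A a then 1 else 0 with hI
  set d := ∑ a, w a * I a with hd
  have hI01 : ∀ a, 0 ≤ I a ∧ I a ≤ 1 := fun a => by simp only [hI]; split_ifs <;> simp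
  have hd0 : 0 ≤ d := Finset.sum_nonneg fun a _ => mul_nonneg (h0 a) (hI01 a).1
  have hd1 : d ≤ 1 := by
    rw [← h1]
    exact Finset.sum_le_sum fun a _ => mul_le_of_le_one_right (h0 a) (hI01 a).2
  have hm' : (0 : ℝ) < m := by exact_mod_cast hm
  have htd : 0 < t - d := sub_pos.2 ht
  have hcard : ∀ f : Fin m → α, (Finset.card {k : Fin m | A (f k)} : ℝ) = ∑ k, I (f k) := by
    intro f
    simp [hI, Finset.sum_boole]
  have hsq : prodMean (fun _ : Fin m => w) (fun f => (∑ k, (I (f k) - d)) ^ 2) ≤ m := by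
    rw [prodMean_sq_sum (w := fun _ : Fin m => w) (fun _ => h1) Finset.univ
      (fun k f => I (f k) - d)]
    · have : ∀ k ∈ (Finset.univ : Finset (Fin m)),
          prodMean (fun _ : Fin m => w) (fun f => (I (f k) - d) ^ 2) ≤ 1 := by
        intro k _
        rw [← prodMean_const (ι := Fin m) (w := fun _ => w) (fun _ => h1) 1]
        refine prodMean_mono (fun _ => h0) fun f => ?_
        have := hI01 (f k)
        nlinarith
      simpa using Finset.sum_le_sum this
    · intro k _ f
      simp only [Function.update_self, mul_sub, Finset.sum_sub_distrib]
      rw [← Finset.sum_mul, h1, one_mul]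
      exact sub_self _
    · intro i _ j _ hij f a
      simp only [Function.update_of_ne hij]
  -- Markov's inequality for the absolute deviation of the count, whose mean is at most `√m` by the
  -- second moment.
  have hle : ∀ f : Fin m → α,
      (if t < (Finset.card {k : Fin m | A (f k)} : ℝ) / m then (1 : ℝ) else 0) ≤
      (m * (t - d))⁻¹ * |∑ k, (I (f k) - d)| := by
    intro f
    split_ifs with h
    · rw [hcard, lt_div_iff₀ hm'] at h
      rw [← div_eq_inv_mul, le_div_iff₀ (mul_pos hm' htd), one_mul]
      refine le_trans ?_ (le_abs_self _)
      rw [Finset.sum_sub_distrib, Finset.sum_const, Finset.card_univ, Fintype.card_fin,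
        nsmul_eq_mul]
      linarith
    · positivity
  calc _ ≤ (m * (t - d))⁻¹ * √m := by
        refine (prodMean_mono (fun _ => h0) hle).trans ?_
        rw [prodMean_const_mul]
        refine mul_le_mul_of_nonneg_left ?_ (by positivity)
        exact (prodMean_abs_le_sqrt (fun _ => h0) (fun _ => h1) _).trans (Real.sqrt_le_sqrt hsq)
    _ = 1 / (√m * (t - d)) := by
        have hs : √(m : ℝ) ≠ 0 := (Real.sqrt_pos.2 hm').ne'
        have hss : √(m : ℝ) * √m = m := Real.mul_self_sqrt hm'.le
        field_simp
        rw [sq, hss]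

section Noise

variable {G : SimpleGraph ℕ} (hG : ∀ C : G.ConnectedComponent, C.supp.encard ≤ 2)
  {p : ℕ → ℝ} {Q : Measure (ℕ → Bool)} (hQ : IsTwoStateLaw p G Q)

/-- The bound on the noise level of the members of a pair. -/
def pairNoise (p : ℕ → ℝ) (Q : Measure (ℕ → Bool)) (u v : ℕ) : ℝ :=
  |sampleCov Q u v| / max (max (p u) (p v)) (max (1 - p u) (1 - p v))

theorem sum_rowProb_mul_ne {n : ℕ} (l : Fin n → ℝ) (v : Fin n) (b : Bool) :
    ∑ z, rowProb id l z * (if z v ≠ b then 1 else 0) = bern (l v) (!b) := by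
  have := prodMean_apply (w := fun (i : Fin n) (b : Bool) => bern (l i) b)
    (fun _ => sum_bern _) v (fun b' => if b' ≠ b then (1 : ℝ) else 0)
  refine this.trans ?_
  cases b <;> simp

include hQ in
/-- The probability that a sample of a member of a pair is corrupted. -/
theorem sum_rowJoint_mul_ne_le {N n : ℕ} (hN : 0 < N) (e : UserPair G n)
    (c : Fin n → Option (Fin (N + 1))) :
    (c e.1.1 = none → ∑ x, ∑ z, rowJoint hG N p Q c x z * (if z e.1.1 ≠ x e.1.1 then 1 else 0) ≤
      pairNoise p Q e.1.1 e.1.2 + 1 / N) ∧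
    (c e.1.2 = none → ∑ x, ∑ z, rowJoint hG N p Q c x z * (if z e.1.2 ≠ x e.1.2 then 1 else 0) ≤
      pairNoise p Q e.1.1 e.1.2 + 1 / N) := by
  have := hQ.isProb
  have k := sum_pairParam_not_le hN (pairLaw_nonneg (Q := Q) e.1.1 e.1.2) (sum_pairLaw _ _)
    (c e.1.1, c e.1.2)
  rw [hQ.pairCov_pairLaw, pairLaw_comp_swap, hQ.fstProb_pairLaw, hQ.fstProb_pairLaw] at k
  simp only [rowJoint, mul_assoc, ← Finset.mul_sum, sum_rowProb_mul_ne, reportParam_fst,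
    reportParam_snd]
  rw [sum_rowLaw_mul n fun x => bern (pairParam N (pairLaw Q e.1.1 e.1.2) (c e.1.1, c e.1.2)
      (x e.1.1, x e.1.2)).1 (!x e.1.1),
    sum_rowLaw_mul n fun x => bern (pairParam N (pairLaw Q e.1.1 e.1.2) (c e.1.1, c e.1.2)
      (x e.1.1, x e.1.2)).2 (!x e.1.2),
    ← sum_pairLaw_mul e.1.1 e.1.2 fun a => bern (pairParam N (pairLaw Q e.1.1 e.1.2)
      (c e.1.1, c e.1.2) a).1 (!a.1),
    ← sum_pairLaw_mul e.1.1 e.1.2 fun a => bern (pairParam N (pairLaw Q e.1.1 e.1.2)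
      (c e.1.1, c e.1.2) a).2 (!a.2)]
  exact k

theorem pairNoise_comm (p : ℕ → ℝ) (Q : Measure (ℕ → Bool)) (u v : ℕ) :
    pairNoise p Q u v = pairNoise p Q v u := by
  rw [pairNoise, pairNoise, max_comm (p u), max_comm (1 - p u), sampleCov, covariance_comm]
  rfl

include hQ in
theorem sum_rowJoint_mul_ne_le_of_adj {N n : ℕ} (hN : 0 < N) {u v : Fin n} (huv : G.Adj u v)
    (c : Fin n → Option (Fin (N + 1))) (hc : c u = none) :
    ∑ x, ∑ z, rowJoint hG N p Q c x z * (if z u ≠ x u then 1 else 0) ≤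
      pairNoise p Q u v + 1 / N := by
  rcases lt_trichotomy u v with h | h | h
  · exact (sum_rowJoint_mul_ne_le hG hQ hN ⟨(u, v), h, huv⟩ c).1 hc
  · exact absurd (congrArg Fin.val h) huv.ne
  · rw [pairNoise_comm]
    exact (sum_rowJoint_mul_ne_le hG hQ hN ⟨(v, u), h, huv.symm⟩ c).2 hc

include hQ in
theorem sum_sum_rowJoint {N n : ℕ} (c : Fin n → Option (Fin (N + 1))) :
    ∑ a : (Fin n → Bool) × (Fin n → Bool), rowJoint hG N p Q c a.1 a.2 = 1 := by
  have := hQ.isProb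
  rw [Fintype.sum_prod_type]
  simp only [sum_rowJoint_right]
  simpa using sum_rowLaw_mul (Q := Q) n fun _ => 1

-- The first term is the probability that the user draws a label, in which case nothing is claimed.
-- Otherwise, given the labels, the rows are i.i.d. and Chebyshev's inequality applies to the flips.
include hG hQ in
theorem corruptionProb_le {n m : ℕ} (hm : 0 < m) {u v : ℕ} (hu : u < n) (hv : v < n)
    (huv : G.Adj u v) {t : ℝ} (ht : pairNoise p Q u v + 1 / gridSize n < t) :
    roundingScheme.corruptionProb G Q n m u t ≤
      1 / ((gridSize n : ℝ) + 1) + 1 / (√m * (t - (pairNoise p Q u v + 1 / gridSize n))) := by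
  classical
  set N := gridSize n with hN
  have hN0 : 0 < N := Nat.succ_pos _
  set d := pairNoise p Q u v + 1 / (N : ℝ) with hd
  have hm' : (0 : ℝ) < m := by exact_mod_cast hm
  let i : Fin n := ⟨u, hu⟩
  let j : Fin n := ⟨v, hv⟩
  let χ : (Fin m → (Fin n → Bool) × (Fin n → Bool)) → ℝ := fun f =>
    if t < (Finset.card {k : Fin m | (f k).2 i ≠ (f k).1 i} : ℝ) / m then 1 else 0
  let K : (Fin n → Option (Fin (N + 1))) → (Fin n → Bool) × (Fin n → Bool) → ℝ := fun c a =>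
    rowJoint hG N p Q c a.1 a.2
  have hK0 : ∀ c a, 0 ≤ K c a := fun c a => rowJoint_nonneg hG N hQ c _ _
  have hK1 : ∀ c, ∑ a, K c a = 1 := fun c => sum_sum_rowJoint hG hQ c
  have e : roundingScheme.corruptionProb G Q n m u t =
      prodMean (fun _ => labelWeight N) (fun c => prodMean (fun _ : Fin m => K c) χ) := by
    have e1 : roundingScheme.corruptionProb G Q n m u t =
        ∑ q : (Fin m → Fin n → Bool) × (Fin m → Fin n → Bool),
          roundingScheme.jointXZ G Q n m q.1 q.2 * χ (fun k => (q.1 k, q.2 k)) := by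
      rw [ObfuscationScheme.corruptionProb, dif_pos hu, Fintype.sum_prod_type]
      refine Finset.sum_congr rfl fun x _ => Finset.sum_congr rfl fun z _ => ?_
      simp only [χ, mul_ite, mul_one, mul_zero]
      congr
    rw [e1]
    simp only [prodMean, Finset.mul_sum]
    rw [Finset.sum_comm, ← (Equiv.arrowProdEquivProdArrow (Fin m) (fun _ => Fin n → Bool)
      (fun _ => Fin n → Bool)).sum_comp]
    refine Finset.sum_congr rfl fun f _ => ?_
    rw [jointXZ_roundingScheme hG hQ, prodMean, Finset.sum_mul]
    refine Finset.sum_congr rfl fun c _ => ?_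
    rw [mul_assoc]
    rfl
  have hc : ∀ c, prodMean (fun _ : Fin m => K c) χ ≤
      (fun a => if a = none then (0 : ℝ) else 1) (c i) + 1 / (√m * (t - d)) := by
    intro c
    have hpos : 0 ≤ 1 / (√(m : ℝ) * (t - d)) := by
      have := sub_pos.2 ht
      positivity
    by_cases hci : c i = none
    · have hdc : ∑ a, K c a * (if a.2 i ≠ a.1 i then 1 else 0) ≤ d := by
        rw [Fintype.sum_prod_type]
        exact sum_rowJoint_mul_ne_le_of_adj hG hQ hN0 (u := i) (v := j) huv c hci
      have h := prodMean_frequency_le (hK0 c) (hK1 c) (fun a => a.2 i ≠ a.1 i) hm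
        (hdc.trans_lt ht)
      simp only [hci, if_true, zero_add]
      refine h.trans ?_
      have := sub_pos.2 ht
      gcongr
    · simp only [hci, if_false]
      refine le_trans ?_ (le_add_of_nonneg_right hpos)
      rw [← prodMean_const (ι := Fin m) (w := fun _ => K c) (fun _ => hK1 c) 1]
      refine prodMean_mono (fun _ => hK0 c) fun f => ?_
      simp only [χ]
      split_ifs <;> norm_num
  rw [e]
  refine (prodMean_mono (fun _ => labelWeight_nonneg N) hc).trans ?_
  rw [prodMean_add, prodMean_const (fun _ => sum_labelWeight N),
    prodMean_apply (w := fun _ : Fin n => labelWeight N) (fun _ => sum_labelWeight N) i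
      (fun a => if a = none then 0 else 1)]
  refine add_le_add_left (le_of_eq ?_) _
  rw [Fintype.sum_option]
  simp only [labelWeight_some, if_true, mul_zero, zero_add, reduceCtorEq, if_false, mul_one,
    Finset.sum_const, Finset.card_univ, Fintype.card_fin, nsmul_eq_mul]
  have : (N : ℝ) + 1 ≠ 0 := by positivity
  push_cast
  field_simp

theorem corruptionProb_nonneg (S : ObfuscationScheme) (G : SimpleGraph ℕ)
    (Q : Measure (ℕ → Bool)) (n m u : ℕ) (t : ℝ) : 0 ≤ S.corruptionProb G Q n m u t := by
  unfold ObfuscationScheme.corruptionProb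
  split_ifs
  · refine Finset.sum_nonneg fun x _ => Finset.sum_nonneg fun z _ => ?_
    split_ifs
    · refine mul_nonneg (Finset.prod_nonneg fun k _ => measureReal_nonneg) ?_
      refine integral_nonneg fun r => Finset.prod_nonneg fun k _ => ?_
      exact mul_nonneg (Finset.prod_nonneg fun _ _ => ENNReal.toReal_nonneg)
        (Finset.prod_nonneg fun _ _ => ENNReal.toReal_nonneg)
    · exact le_rfl
  · exact le_rfl

-- Excludes negative levels, so that the infimum defining the noise level is over a set bounded
-- below.
include hG hQ in
theorem corruptionProb_of_neg {n m u : ℕ} (hu : u < n) {t : ℝ} (ht : t < 0) :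
    roundingScheme.corruptionProb G Q n m u t = 1 := by
  have := hQ.isProb
  have hfrac : ∀ s : Finset (Fin m), t < (s.card : ℝ) / m := fun s => ht.trans_le (by positivity)
  rw [ObfuscationScheme.corruptionProb, dif_pos hu]
  simp only [hfrac, if_true, sum_jointXZ_right hG hQ]
  rw [← Fintype.prod_sum fun (_ : Fin m) x => rowLaw Q n x]
  have hsum : ∑ x : Fin n → Bool, rowLaw Q n x = 1 := by
    simpa using sum_rowLaw_mul (Q := Q) n fun _ => 1
  rw [hsum, Finset.prod_const_one]

theorem tendsto_gridSize : Tendsto (fun n => (gridSize n : ℝ)) atTop atTop := by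
  have hs : Tendsto Nat.sqrt atTop atTop :=
    tendsto_atTop_atTop.2 fun b => ⟨b * b, fun a ha => Nat.le_sqrt.2 ha⟩
  exact tendsto_natCast_atTop_atTop.comp ((tendsto_add_atTop_nat 1).comp (hs.comp hs))

include hG hQ in
theorem tendsto_corruptionProb {m : ℕ → ℕ} (hm : Tendsto m atTop atTop) {u v : ℕ}
    (huv : G.Adj u v) {t : ℝ} (ht : pairNoise p Q u v < t) :
    Tendsto (fun n => roundingScheme.corruptionProb G Q n (m n) u t) atTop (𝓝 0) := by
  have hinv : Tendsto (fun n => 1 / (gridSize n : ℝ)) atTop (𝓝 0) :=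
    tendsto_gridSize.const_div_atTop 1
  have h1 : Tendsto (fun n => 1 / ((gridSize n : ℝ) + 1)) atTop (𝓝 0) :=
    (tendsto_atTop_add_const_right _ 1 tendsto_gridSize).const_div_atTop 1
  have h2 : Tendsto (fun n => t - (pairNoise p Q u v + 1 / (gridSize n : ℝ))) atTop
      (𝓝 (t - pairNoise p Q u v)) := by
    simpa using (hinv.const_add (pairNoise p Q u v)).const_sub t
  have h3 : Tendsto (fun n => √(m n : ℝ)) atTop atTop :=
    Real.tendsto_sqrt_atTop.comp (tendsto_natCast_atTop_atTop.comp hm)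
  have h4 := h1.add ((h3.atTop_mul_pos (sub_pos.2 ht) h2).const_div_atTop 1)
  rw [add_zero] at h4
  refine tendsto_of_tendsto_of_tendsto_of_le_of_le' tendsto_const_nhds h4
    (Eventually.of_forall fun n => corruptionProb_nonneg _ _ _ _ _ _ _) ?_
  filter_upwards [eventually_gt_atTop u, eventually_gt_atTop v, hm.eventually_gt_atTop 0,
    hinv.eventually_lt_const (sub_pos.2 ht)] with n hu hv hmn hn
  exact corruptionProb_le hG hQ hmn hu hv huv (by linarith)

include hG hQ in
theorem asymptoticNoiseLevel_le {m : ℕ → ℕ} (hm : Tendsto m atTop atTop) {u v : ℕ}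
    (huv : G.Adj u v) :
    roundingScheme.asymptoticNoiseLevel G Q m u ≤ pairNoise p Q u v := by
  -- Every level above `pairNoise` is admissible in the infimum.
  refine le_of_forall_gt_imp_ge_of_dense fun t ht => csInf_le ⟨0, fun s hs => ?_⟩
    (tendsto_corruptionProb hG hQ hm huv ht)
  by_contra! hneg
  have h1 : Tendsto (fun n => roundingScheme.corruptionProb G Q n (m n) u s) atTop (𝓝 1) :=
    tendsto_const_nhds.congr' (by
      filter_upwards [eventually_gt_atTop u] with n hn
      exact (corruptionProb_of_neg hG hQ hn hneg).symm)
  exact zero_ne_one (tendsto_nhds_unique hs h1)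

end Noise

end

theorem theorem5
    {Ω : Type*} [MeasurableSpace Ω] (μ : Measure Ω) [IsProbabilityMeasure μ]
    (f : ℝ → ℝ) (hf : Measurable f) (δ₁ δ₂ : ℝ) (hδ₁ : 0 < δ₁) (hδ₂ : 0 < δ₂)
    (hf_mem : ∀ t ∈ Set.Ioo (0 : ℝ) 1, δ₁ ≤ f t ∧ f t ≤ δ₂)
    (hf_notMem : ∀ t ∉ Set.Ioo (0 : ℝ) 1, f t = 0)
    (P : ℕ → Ω → ℝ) (hP_meas : ∀ u, Measurable (P u)) (hP_indep : iIndepFun P μ)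
    (hP_law : ∀ u, μ.map (P u) = volume.withDensity (fun t => ENNReal.ofReal (f t)))
    (G : SimpleGraph ℕ) (hG : ∀ C : G.ConnectedComponent, C.supp.encard ≤ 2) :
    ∃ S : ObfuscationScheme,
      ∀ᵐ ω ∂μ, ∀ Q : Measure (ℕ → Bool), IsTwoStateLaw (fun u => P u ω) G Q →
        ∀ m : ℕ → ℕ, Tendsto m atTop atTop →
          (∀ u u' : ℕ, G.Adj u u' →
            S.asymptoticNoiseLevel G Q m u ≤
                |sampleCov Q u u'| / max (max (P u ω) (P u' ω)) (max (1 - P u ω) (1 - P u' ω)) ∧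
              S.asymptoticNoiseLevel G Q m u' ≤
                |sampleCov Q u u'| / max (max (P u ω) (P u' ω)) (max (1 - P u ω) (1 - P u' ω))) ∧
          ∀ u : ℕ, S.PerfectPrivacy G Q m u := by
  -- One null set serves all of the countably many users, since the density vanishes off the open
  -- interval.
  have hmem : ∀ᵐ ω ∂μ, ∀ u, P u ω ∈ Set.Ioo (0 : ℝ) 1 := by
    refine ae_all_iff.2 fun u => ?_
    have h : ∀ᵐ t ∂(μ.map (P u)), t ∈ Set.Ioo (0 : ℝ) 1 := by
      rw [hP_law u, ae_withDensity_iff hf.ennreal_ofReal]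
      refine ae_of_all _ fun t ht => ?_
      by_contra hn
      exact ht (by simp [hf_notMem t hn])
    exact ae_of_ae_map (hP_meas u).aemeasurable h
  refine ⟨roundingScheme, ?_⟩
  filter_upwards [hmem] with ω hω Q hQ m hm
  refine ⟨fun u u' huu' => ⟨asymptoticNoiseLevel_le hG hQ hm huu', ?_⟩, fun u =>
    perfectPrivacy_roundingScheme hG hQ m u (hω u).1 (hω u).2⟩
  -- The bound is symmetric in the two users of the pair.
  have := asymptoticNoiseLevel_le hG hQ hm huu'.symm
  rwa [pairNoise_comm] at this
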